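/- Let $n\ge 1$. A real $n\times n$ matrix $A$ is an anisotropic dilation matrix if every eigenvalue $\lambda\in\mathbb C$ of $A$ satisfies $|\lambda|>1$. A homogeneous quasi-norm associated with $A$ is a (Lebesgue) measurable function $\rho:\mathbb R^n\to[0,\infty)$ such that $\rho(x)=0$ if and only if $x=0$, $\rho(Ax)=|\det A|\,\rho(x)$ for all $x$, and, for some constant $c>0$, $\rho(x+y)\le c(\rho(x)+\rho(y))$ for all $x,y\in\mathbb R^n$. Two dilation matrices $A_1,A_2$ are equivalent if each has an associated homogeneous quasi-norm and, for all homogeneous quasi-norms $\rho_1$ associated with $A_1$ and $\rho_2$ associated with $A_2$, there is $C>0$ with $\frac1C\rho_1(x)\le\rho_2(x)\le C\rho_1(x)$ for all $x\in\mathbb R^n$. A continuous group is a family $\{A_t\}_{t>0}$ of real $n\times n$ matrices, continuous in $t$, with $A_1=I$ and $A_sA_t=A_{st}$ for all $s,t>0$; a real $n\times n$ matrix $P$ is its generator if $A_t=\exp(P\ln t)$ for all $t>0$. **Theorem 3.1.** Let $A$ be an $n\times n$ anisotropic dilation matrix. Then there exists a unique continuous group $\{A_t=\exp(P\ln t)\}_{t>0}$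 such that (i) all complex eigenvalues of its generator $P$ are positive real numbers, and $\operatorname{tr}(P)=1$; and (ii) for all $t>1$, $A_t$ is an anisotropic dilation matrix and $A$ is equivalent to $A_t$. More precisely, if $\{A'_t=\exp(P'\ln t)\}_{t>0}$ is another continuous group whose generator $P'$ satisfies (i), and $A$ is equivalent to $A'_t$ for some $t>1$, then $P'=P$. -/

import Mathlib

open MeasureTheory

/-- `μ` is an eigenvalue, real or complex, of the real square matrix `M`. -/
def IsComplexEigenvalue {n : ℕ} (M : Matrix (Fin n) (Fin n) ℝ) (μ : ℂ) : Prop :=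
  Module.End.HasEigenvalue (Matrix.toLin' (M.map (algebraMap ℝ ℂ))) μ

/-- An anisotropic dilation matrix: all eigenvalues, real or complex, have modulus `> 1`. -/
def IsAnisotropicDilation {n : ℕ} (A : Matrix (Fin n) (Fin n) ℝ) : Prop :=
  ∀ μ : ℂ, IsComplexEigenvalue A μ → 1 < ‖μ‖

/-- All eigenvalues of `P`, including the complex ones, are positive real numbers. -/
def HasPositiveEigenvalues {n : ℕ} (P : Matrix (Fin n) (Fin n) ℝ) : Prop :=
  ∀ μ : ℂ, IsComplexEigenvalue P μ → ∃ r : ℝ, 0 < r ∧ μ = (r : ℂ)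

/-- `ρ` is a homogeneous quasi-norm on `ℝⁿ` associated with `A`: a nonnegative Lebesgue measurable
function that vanishes exactly at `0`, scales by `|det A|` under `A`, and satisfies a
quasi-triangle inequality. -/
structure IsHomogeneousQuasiNorm {n : ℕ} (A : Matrix (Fin n) (Fin n) ℝ)
    (ρ : (Fin n → ℝ) → ℝ) : Prop where
  measurable : NullMeasurable ρ (volume : Measure (Fin n → ℝ))
  nonneg : ∀ x, 0 ≤ ρ x
  eq_zero_iff : ∀ x, ρ x = 0 ↔ x = 0
  homogeneous : ∀ x, ρ (A.mulVec x) = |A.det| * ρ x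
  quasi_triangle : ∃ c : ℝ, 0 < c ∧ ∀ x y, ρ (x + y) ≤ c * (ρ x + ρ y)

/-- Two functions on `ℝⁿ` (in use: quasi-norms) are comparable up to a multiplicative constant. -/
def QuasiNormsEquivalent {n : ℕ} (ρ₁ ρ₂ : (Fin n → ℝ) → ℝ) : Prop :=
  ∃ C : ℝ, 0 < C ∧ ∀ x, 1 / C * ρ₁ x ≤ ρ₂ x ∧ ρ₂ x ≤ C * ρ₁ x

/-- Two dilations are equivalent if their associated quasi-norms are equivalent. A dilation has
many associated quasi-norms: every pair is required to be equivalent, and the existence of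
associated quasi-norms is part of the notion, so that it never holds vacuously. -/
structure DilationsEquivalent {n : ℕ} (A₁ A₂ : Matrix (Fin n) (Fin n) ℝ) : Prop where
  exists_left : ∃ ρ, IsHomogeneousQuasiNorm A₁ ρ
  exists_right : ∃ ρ, IsHomogeneousQuasiNorm A₂ ρ
  equivalent : ∀ ρ₁ ρ₂, IsHomogeneousQuasiNorm A₁ ρ₁ → IsHomogeneousQuasiNorm A₂ ρ₂ →
    QuasiNormsEquivalent ρ₁ ρ₂

/-- A continuous group `{A_t}_{t > 0}` on `ℝⁿ`: `A_1 = I`, `A_s A_t = A_{st}`, and `t ↦ A_t` is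
continuous (entrywise, which is the same as continuity of `t ↦ A_t x` for every `x`). -/
abbrev ContinuousGroup (n : ℕ) : Type :=
  {t : ℝ // 0 < t} →ₜ* Matrix (Fin n) (Fin n) ℝ

/-- `P` is the generator of `{A_t}`: `A_t = exp (P ln t)` for all `t > 0`. -/
def HasGenerator {n : ℕ} (G : ContinuousGroup n) (P : Matrix (Fin n) (Fin n) ℝ) : Prop :=
  ∀ t : {t : ℝ // 0 < t}, G t = NormedSpace.exp (Real.log (t : ℝ) • P)

/-!
Equivalence of two dilations says that suitably matched powers of them differ by bounded factors.
Indeed every quasi-norm of a dilation `B`, although only measurable, is bounded on bounded sets (by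
Steinhaus' theorem, `IsHomogeneousQuasiNorm.eventually_le`) and bounded below away from the origin
(`IsHomogeneousQuasiNorm.exists_pos_le_of_le_norm`). By homogeneity its size is then governed by
the power of `B` that brings a vector into a fixed shell around the origin, which gives the
criterion `quasiNormsEquivalent_of_zpow_eq`.

For existence, a dilation is factored as `A = exp D * U`, where `D` has positive eigenvalues and
`U` commutes with `D` and has bounded powers (`IsAnisotropicDilation.exists_exp_mul`): `D` takes
the logarithms of the moduli of the eigenvalues of the semisimple part of `A`, and the logarithm of
its unipotent part, while `U` collects the phases. Then `|det U| = 1`, so `tr D = log |det A| > 0`,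
and `P = D / tr D` generates a group as required. The powers `A ^ k` and `exp (m τ P)`, where `m τ`
is the multiple of `τ` next below `k tr D`, differ by the bounded factor `exp (θ P) * U ^ k` with
`0 ≤ θ < τ`.

For uniqueness, equivalence of `exp (τ P)` and `exp (τ P')`, which have the same determinant because
both traces are `1`, makes `exp (-k τ P) * exp (k τ P')` bounded for `k : ℤ`. The entries of this
product are exponential polynomials in `k` with real exponents, so it is constant; this is the
rigidity lemma `eq_of_norm_exp_neg_mul_exp_le`, proved by linear algebra for the operator
`X ↦ X P' - P X`.
-/

open Filter Topology

attribute [local instance] Matrix.linftyOpNormedRing Matrix.linftyOpNormedAlgebra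

/-! ### Complex eigenvalues and inverse powers of a dilation -/

theorem isComplexEigenvalue_iff_mem_spectrum {n : ℕ} (M : Matrix (Fin n) (Fin n) ℝ) (μ : ℂ) :
    IsComplexEigenvalue M μ ↔ μ ∈ spectrum ℂ (M.map (algebraMap ℝ ℂ)) := by
  rw [IsComplexEigenvalue, Module.End.hasEigenvalue_iff_mem_spectrum, Matrix.spectrum_toLin']

theorem isComplexEigenvalue_iff_exists_mulVec {n : ℕ} (M : Matrix (Fin n) (Fin n) ℝ) (μ : ℂ) :
    IsComplexEigenvalue M μ ↔ ∃ v, v ≠ 0 ∧ (M.map (algebraMap ℝ ℂ)).mulVec v = μ • v := by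
  constructor
  · intro h
    obtain ⟨v, hv⟩ := h.exists_hasEigenvector
    exact ⟨v, hv.2, by simpa using hv.apply_eq_smul⟩
  · rintro ⟨v, hv, h⟩
    exact Module.End.hasEigenvalue_of_hasEigenvector
      (x := v) ⟨Module.End.mem_eigenspace_iff.2 (by simpa using h), hv⟩

theorem norm_map_algebraMap {n : ℕ} (M : Matrix (Fin n) (Fin n) ℝ) :
    ‖M.map (algebraMap ℝ ℂ)‖ = ‖M‖ := by
  simp [Matrix.linfty_opNorm_def]

theorem IsAnisotropicDilation.isUnit {n : ℕ} {A : Matrix (Fin n) (Fin n) ℝ}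
    (hA : IsAnisotropicDilation A) : IsUnit A := by
  have h0 : IsUnit (A.map (algebraMap ℝ ℂ)) := by
    by_contra h
    have := hA 0 ((isComplexEigenvalue_iff_mem_spectrum _ _).2 (spectrum.zero_mem ℂ h))
    simp at this
    linarith
  rw [Matrix.isUnit_iff_isUnit_det] at h0 ⊢
  have : (A.map (algebraMap ℝ ℂ)).det = algebraMap ℝ ℂ A.det :=
    (RingHom.map_det (algebraMap ℝ ℂ) A).symm
  rw [this] at h0
  simpa using h0

/-- The inverse powers of a dilation decay geometrically: by Gelfand's formula the spectral radius
of the inverse, which is less than `1`, governs the growth of its powers. -/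
theorem IsAnisotropicDilation.eventually_norm_inv_pow_le {n : ℕ}
    {A : (Matrix (Fin n) (Fin n) ℝ)ˣ} (hA : IsAnisotropicDilation A.val) :
    ∃ θ : ℝ, 0 < θ ∧ θ < 1 ∧
      ∀ᶠ k : ℕ in atTop, ‖(A⁻¹ ^ k).val‖ ≤ θ ^ k := by
  rcases Nat.eq_zero_or_pos n with rfl | hn
  · refine ⟨1 / 2, by norm_num, by norm_num, Eventually.of_forall fun k => ?_⟩
    rw [Subsingleton.elim (A⁻¹ ^ k).val 0, norm_zero]
    positivity
  have : Nonempty (Fin n) := ⟨⟨0, hn⟩⟩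
  let f : Matrix (Fin n) (Fin n) ℝ →+* Matrix (Fin n) (Fin n) ℂ := (algebraMap ℝ ℂ).mapMatrix
  let a : (Matrix (Fin n) (Fin n) ℂ)ˣ := Units.map f.toMonoidHom A
  have ha : a.val =
    A.val.map (algebraMap ℝ ℂ) := rfl
  have hr : spectralRadius ℂ a⁻¹.val
      < (1 : NNReal) := by
    refine spectrum.spectralRadius_lt_of_forall_lt _ fun z hz => ?_
    have hz0 : z ≠ 0 := spectrum.ne_zero_of_mem_of_unit hz
    have h1 := hA z⁻¹ ((isComplexEigenvalue_iff_mem_spectrum _ _).2 (by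
      rw [← ha]
      have := (spectrum.inv_mem_iff (r := Units.mk0 z hz0) (a := a⁻¹)).1 hz
      simpa using this))
    rw [norm_inv] at h1
    rw [← NNReal.coe_lt_coe]
    simpa using (one_lt_inv₀ (norm_pos_iff.2 hz0)).1 h1
  obtain ⟨t, ht1, ht2⟩ := ENNReal.lt_iff_exists_nnreal_btwn.1 hr
  have hlim := (spectrum.pow_nnnorm_pow_one_div_tendsto_nhds_spectralRadius
    a⁻¹.val).eventually
      (gt_mem_nhds ht1)
  have ht0 : 0 < t := by
    have := (zero_le).trans_lt ht1
    exact_mod_cast this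
  refine ⟨t, by exact_mod_cast ht0, by exact_mod_cast ht2, ?_⟩
  filter_upwards [hlim, eventually_gt_atTop 0] with k hk hk0
  have h2 := ENNReal.rpow_le_rpow hk.le (z := (k : ℝ)) (by positivity)
  rw [← ENNReal.rpow_mul, one_div, inv_mul_cancel₀ (by positivity), ENNReal.rpow_one,
    ENNReal.rpow_natCast] at h2
  have h3 : ‖(a⁻¹.val) ^ k‖₊ ≤ t ^ k := by
    exact_mod_cast h2
  rw [← norm_map_algebraMap]
  have h4 : (A⁻¹ ^ k).val.map
      (algebraMap ℝ ℂ) = (a⁻¹.val) ^ k := by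
    rw [← Units.val_pow_eq_pow_val]
    change f _ = _
    simp only [a]
    rw [← map_inv, ← map_pow]
    rfl
  rw [h4]
  exact_mod_cast h3

theorem IsAnisotropicDilation.tendsto_inv_pow {n : ℕ}
    {A : (Matrix (Fin n) (Fin n) ℝ)ˣ} (hA : IsAnisotropicDilation A.val) :
    Tendsto (fun k : ℕ => (A⁻¹ ^ k).val)
      atTop (𝓝 0) := by
  obtain ⟨θ, h0, h1, h⟩ := hA.eventually_norm_inv_pow_le
  exact squeeze_zero_norm' h (tendsto_pow_atTop_nhds_zero_of_lt_one h0.le h1)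

theorem IsAnisotropicDilation.one_lt_abs_det {n : ℕ} (hn : 0 < n)
    {A : (Matrix (Fin n) (Fin n) ℝ)ˣ} (hA : IsAnisotropicDilation A.val) :
    1 < |A.val.det| := by
  have : Nonempty (Fin n) := ⟨⟨0, hn⟩⟩
  have h := ((continuous_id.matrix_det).tendsto (0 : Matrix (Fin n) (Fin n) ℝ)).comp
    hA.tendsto_inv_pow
  simp only [id, Matrix.det_zero] at h
  have h' : Tendsto (fun k : ℕ =>
      A⁻¹.val.det ^ k) atTop (𝓝 0) := by
    simpa [Function.comp_def, Matrix.det_pow] using h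
  rw [tendsto_pow_atTop_nhds_zero_iff] at h'
  have h2 : A.val.det *
      A⁻¹.val.det = 1 := by
    rw [← Matrix.det_mul, Units.mul_inv, Matrix.det_one]
  have h3 : |A.val.det| *
      |A⁻¹.val.det| = 1 := by
    rw [← abs_mul, h2, abs_one]
  by_contra! hle
  have := abs_nonneg (A⁻¹.val.det)
  nlinarith

/-! ### Existence of homogeneous quasi-norms -/

theorem min_one_norm_add_pow_le {E : Type*} [SeminormedAddCommGroup E] (x y : E) (m : ℕ) :
    (min 1 ‖x + y‖) ^ m ≤ 2 ^ (m - 1) * ((min 1 ‖x‖) ^ m + (min 1 ‖y‖) ^ m) := by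
  refine le_trans (pow_le_pow_left₀ (by positivity) ?_ m)
    (add_pow_le (by positivity : 0 ≤ min 1 ‖x‖) (by positivity : 0 ≤ min 1 ‖y‖) m)
  have h := norm_add_le x y
  have hx := norm_nonneg x
  have hy := norm_nonneg y
  rcases le_total 1 ‖x‖ with h1 | h1 <;> rcases le_total 1 ‖y‖ with h2 | h2 <;>
    simp only [min_eq_left, min_eq_right, h1, h2] <;>
    first
      | exact (min_le_left _ _).trans (by linarith)
      | exact (min_le_right _ _).trans (by linarith)

/-- Every dilation has an associated quasi-norm. With `b = |det B|`, the series
`∑ k : ℤ, b ^ k * (min 1 ‖B ^ (-k) x‖) ^ m` is homogeneous because its index can be shifted, and it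
converges as soon as `m` is so large that the decay of `B ^ (-k)` to the power `m` beats `b ^ k`. -/
theorem IsAnisotropicDilation.exists_isHomogeneousQuasiNorm {n : ℕ} (hn : 0 < n)
    {B : (Matrix (Fin n) (Fin n) ℝ)ˣ} (hB : IsAnisotropicDilation B.val) :
    ∃ ρ, IsHomogeneousQuasiNorm B.val ρ := by
  obtain ⟨θ, hθ0, hθ1, hθ⟩ := hB.eventually_norm_inv_pow_le
  have hb : 1 < |B.val.det| := hB.one_lt_abs_det hn
  set b := |B.val.det| with hbdef
  have hb0 : 0 < b := by linarith
  obtain ⟨m, hm⟩ := exists_pow_lt_of_lt_one (inv_pos.2 hb0) hθ1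
  have hm0 : m ≠ 0 := by
    rintro rfl
    rw [pow_zero] at hm
    exact absurd hm (not_lt.2 (inv_le_one_of_one_le₀ hb.le))
  have hbθ : b * θ ^ m < 1 := by
    calc b * θ ^ m < b * b⁻¹ := by gcongr
      _ = 1 := mul_inv_cancel₀ hb0.ne'
  let F : (Fin n → ℝ) → ℤ → ℝ := fun x k => b ^ k * (min 1 ‖(B ^ (-k)).val.mulVec x‖) ^ m
  have hF0 : ∀ x k, 0 ≤ F x k := fun x k => by positivity
  have hsum : ∀ x, Summable (F x) := by
    intro x
    refine Summable.of_nat_of_neg ?_ ?_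
    · have hg : Summable fun k : ℕ => (b * θ ^ m) ^ k * ‖x‖ ^ m :=
        (summable_geometric_of_lt_one (by positivity) hbθ).mul_right _
      refine hg.of_norm_bounded_eventually_nat ?_
      filter_upwards [hθ] with k hk
      rw [Real.norm_of_nonneg (hF0 _ _)]
      have h1 : ‖(B ^ (-(k : ℤ))).val.mulVec x‖ ≤ θ ^ k * ‖x‖ := by
        refine (Matrix.linfty_opNorm_mulVec _ _).trans ?_
        rw [zpow_neg, zpow_natCast, ← inv_pow]
        gcongr
      calc F x k ≤ b ^ k * (θ ^ k * ‖x‖) ^ m := by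
            simp only [F, zpow_natCast]
            gcongr
            exact (min_le_right _ _).trans h1
        _ = (b * θ ^ m) ^ k * ‖x‖ ^ m := by ring
    · have hg : Summable fun k : ℕ => (b⁻¹) ^ k :=
        summable_geometric_of_lt_one (by positivity) (inv_lt_one_of_one_lt₀ hb)
      refine hg.of_nonneg_of_le (fun k => hF0 _ _) fun k => ?_
      simp only [F, zpow_neg, zpow_natCast, inv_pow]
      exact mul_le_of_le_one_right (by positivity)
        (pow_le_one₀ (by positivity) (min_le_left _ _))
  refine ⟨fun x => ∑' k, F x k, ?_, fun x => tsum_nonneg (hF0 x), fun x => ⟨fun h => ?_, ?_⟩,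
    fun x => ?_, 2 ^ (m - 1), by positivity, fun x y => ?_⟩
  · refine Measurable.nullMeasurable ?_
    refine measurable_of_tendsto_metrizable' (u := (atTop : Filter (Finset ℤ)))
      (f := fun s x => ∑ k ∈ s, F x k) (fun s => ?_)
      (tendsto_pi_nhds.2 fun x => (hsum x).hasSum)
    refine Finset.measurable_sum _ fun k _ => Continuous.measurable ?_
    exact continuous_const.mul ((continuous_const.min
      (Continuous.matrix_mulVec continuous_const continuous_id).norm).pow m)
  · have h0 := (hasSum_zero_iff_of_nonneg (hF0 x)).1 (h ▸ (hsum x).hasSum)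
    have h1 : F x 0 = 0 := congrFun h0 0
    simp only [F, zpow_zero, one_mul, neg_zero, Units.val_one, Matrix.one_mulVec] at h1
    have h2 := pow_eq_zero_iff hm0 |>.1 h1
    by_contra hx
    exact absurd h2 (lt_min one_pos (norm_pos_iff.2 hx)).ne'
  · rintro rfl
    simp [F, hm0]
  · change ∑' k, F (B.val.mulVec x) k = b * ∑' k, F x k
    rw [← tsum_mul_left, ← (Equiv.addRight (1 : ℤ)).tsum_eq]
    refine tsum_congr fun k => ?_
    simp only [F, Equiv.coe_addRight, Matrix.mulVec_mulVec, ← Units.val_mul]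
    rw [zpow_add₀ hb0.ne', zpow_one, neg_add, zpow_add, zpow_neg_one, inv_mul_cancel_right]
    ring
  · rw [← (hsum x).tsum_add (hsum y), ← tsum_mul_left]
    refine (hsum _).tsum_le_tsum (fun k => ?_) (((hsum x).add (hsum y)).mul_left _)
    simp only [F, Matrix.mulVec_add]
    calc _ ≤ b ^ k * (2 ^ (m - 1) * ((min 1 ‖(B ^ (-k)).val.mulVec x‖) ^ m +
          (min 1 ‖(B ^ (-k)).val.mulVec y‖) ^ m)) := by
          gcongr
          exact min_one_norm_add_pow_le _ _ _
      _ = _ := by ring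

/-! ### Bounds for an arbitrary homogeneous quasi-norm -/

theorem IsHomogeneousQuasiNorm.apply_zpow_mulVec {n : ℕ} {B : (Matrix (Fin n) (Fin n) ℝ)ˣ}
    {ρ : (Fin n → ℝ) → ℝ} (hρ : IsHomogeneousQuasiNorm B.val ρ) (k : ℤ) (x : Fin n → ℝ) :
    ρ ((B ^ k).val.mulVec x) = |B.val.det| ^ k * ρ x := by
  have hb : |B.val.det| ≠ 0 :=
    abs_ne_zero.2 ((Matrix.isUnit_iff_isUnit_det _).1 B.isUnit).ne_zero
  have hnat : ∀ (k : ℕ) (x : Fin n → ℝ), ρ ((B ^ k).val.mulVec x) = |B.val.det| ^ k * ρ x := by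
    intro k
    induction k with
    | zero => simp
    | succ k ih =>
      intro x
      rw [pow_succ, Units.val_mul, ← Matrix.mulVec_mulVec, ih, hρ.homogeneous]
      ring
  obtain ⟨k, rfl | rfl⟩ := k.eq_nat_or_neg
  · simpa using hnat k x
  · have h := hnat k ((B ^ (-(k : ℤ))).val.mulVec x)
    rw [Matrix.mulVec_mulVec, ← Units.val_mul, zpow_neg, zpow_natCast, mul_inv_cancel,
      Units.val_one, Matrix.one_mulVec] at h
    rw [zpow_neg, zpow_natCast, zpow_neg, zpow_natCast, h, inv_mul_cancel_left₀ (pow_ne_zero _ hb)]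

/-- A quasi-norm is bounded near the origin. As it is measurable, some set
`{x | ρ x ≤ N ∧ ρ (-x) ≤ N}` has positive measure; by Steinhaus' theorem its difference set is a
neighbourhood of the origin, and there the quasi-triangle inequality bounds `ρ`. The condition on
`-x` makes up for the missing symmetry of `ρ`. -/
theorem IsHomogeneousQuasiNorm.eventually_le {n : ℕ} {B : Matrix (Fin n) (Fin n) ℝ}
    {ρ : (Fin n → ℝ) → ℝ} (hρ : IsHomogeneousQuasiNorm B ρ) :
    ∃ M : ℝ, ∀ᶠ x in 𝓝 0, ρ x ≤ M := by
  obtain ⟨c, hc, hadd⟩ := hρ.quasi_triangle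
  let E : ℕ → Set (Fin n → ℝ) := fun k => {x | ρ x ≤ k ∧ ρ (-x) ≤ k}
  have hE : ∀ k, NullMeasurableSet (E k) (volume : Measure (Fin n → ℝ)) := by
    intro k
    have h1 : NullMeasurableSet {x | ρ x ≤ k} (volume : Measure (Fin n → ℝ)) :=
      hρ.measurable measurableSet_Iic
    exact h1.inter (h1.preimage (Measure.measurePreserving_neg volume).quasiMeasurePreserving)
  have hU : (⋃ k, E k) = Set.univ := by
    refine Set.eq_univ_of_forall fun x => Set.mem_iUnion.2 ?_
    obtain ⟨k, hk⟩ := exists_nat_ge (max (ρ x) (ρ (-x)))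
    exact ⟨k, (le_max_left _ _).trans hk, (le_max_right _ _).trans hk⟩
  obtain ⟨k, hk⟩ : ∃ k, 0 < (volume : Measure (Fin n → ℝ)) (E k) := by
    refine exists_measure_pos_of_not_measure_iUnion_null ?_
    rw [hU]
    exact (Measure.measure_univ_pos.2 (NeZero.ne _)).ne'
  obtain ⟨t, htE, htm, hte⟩ := (hE k).exists_measurable_subset_ae_eq
  have ht := Measure.sub_mem_nhds_zero_of_addHaar_pos volume t htm (by rwa [measure_congr hte])
  refine ⟨c * (k + k), ?_⟩
  filter_upwards [ht] with x hx
  obtain ⟨y, hy, z, hz, rfl⟩ := Set.mem_sub.1 hx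
  rw [sub_eq_add_neg]
  refine (hadd _ _).trans ?_
  gcongr
  · exact (htE hy).1
  · exact (htE hz).2

theorem IsAnisotropicDilation.exists_norm_inv_pow_lt {n : ℕ}
    {B : (Matrix (Fin n) (Fin n) ℝ)ˣ} (hB : IsAnisotropicDilation B.val) {ε : ℝ} (hε : 0 < ε) :
    ∃ N : ℕ, ∀ k ≥ N, ‖(B⁻¹ ^ k).val‖ < ε := by
  have h := hB.tendsto_inv_pow.norm
  rw [norm_zero] at h
  exact eventually_atTop.1 (h.eventually (gt_mem_nhds hε))

theorem IsHomogeneousQuasiNorm.exists_le_of_norm_le {n : ℕ} {B : (Matrix (Fin n) (Fin n) ℝ)ˣ}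
    (hB : IsAnisotropicDilation B.val)
    {ρ : (Fin n → ℝ) → ℝ} (hρ : IsHomogeneousQuasiNorm B.val ρ) (R : ℝ) :
    ∃ M : ℝ, 0 < M ∧ ∀ x, ‖x‖ ≤ R → ρ x ≤ M := by
  obtain ⟨M, hM⟩ := hρ.eventually_le
  obtain ⟨ε, hε, hεM⟩ := Metric.eventually_nhds_iff.1 hM
  obtain ⟨N, hN⟩ := hB.exists_norm_inv_pow_lt (div_pos hε (by positivity : 0 < |R| + 1))
  refine ⟨|B.val.det| ^ (N : ℤ) * |M| + 1, by positivity, fun x hx => ?_⟩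
  have h1 : ‖(B⁻¹ ^ N).val.mulVec x‖ < ε := by
    calc _ ≤ ‖(B⁻¹ ^ N).val‖ * ‖x‖ := Matrix.linfty_opNorm_mulVec _ _
      _ ≤ ‖(B⁻¹ ^ N).val‖ * (|R| + 1) := by
        gcongr
        exact hx.trans ((le_abs_self R).trans (by linarith))
      _ < ε / (|R| + 1) * (|R| + 1) := by
        gcongr
        exact hN N le_rfl
      _ = ε := div_mul_cancel₀ _ (by positivity)
  have h2 := hρ.apply_zpow_mulVec N ((B⁻¹ ^ N).val.mulVec x)
  rw [Matrix.mulVec_mulVec, ← Units.val_mul, zpow_natCast, inv_pow, mul_inv_cancel,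
    Units.val_one, Matrix.one_mulVec, ← inv_pow] at h2
  have h3 := hεM (y := (B⁻¹ ^ N).val.mulVec x) (by simpa using h1)
  rw [h2]
  have : ρ ((B⁻¹ ^ N).val.mulVec x) ≤ |M| := h3.trans (le_abs_self M)
  have h4 : |B.val.det| ^ (N : ℤ) * ρ ((B⁻¹ ^ N).val.mulVec x) ≤ |B.val.det| ^ (N : ℤ) * |M| := by
    gcongr
  linarith

theorem IsHomogeneousQuasiNorm.eventually_lt {n : ℕ} (hn : 0 < n)
    {B : (Matrix (Fin n) (Fin n) ℝ)ˣ} (hB : IsAnisotropicDilation B.val)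
    {ρ : (Fin n → ℝ) → ℝ} (hρ : IsHomogeneousQuasiNorm B.val ρ) {η : ℝ} (hη : 0 < η) :
    ∀ᶠ x in 𝓝 0, ρ x < η := by
  obtain ⟨M, hM⟩ := hρ.eventually_le
  have hb := hB.one_lt_abs_det hn
  obtain ⟨k, hk⟩ := pow_unbounded_of_one_lt (M / η) hb
  have hcont : Tendsto (fun x : Fin n → ℝ => (B ^ (k : ℤ)).val.mulVec x) (𝓝 0) (𝓝 0) := by
    have : Continuous fun x : Fin n → ℝ => (B ^ (k : ℤ)).val.mulVec x :=
      Continuous.matrix_mulVec continuous_const continuous_id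
    simpa using this.tendsto 0
  filter_upwards [hcont.eventually hM] with x hx
  rw [hρ.apply_zpow_mulVec, zpow_natCast] at hx
  rw [div_lt_iff₀ hη] at hk
  exact lt_of_mul_lt_mul_left (hx.trans_lt hk) (by positivity)

/-- A quasi-norm is bounded below by a positive constant on every compact set that omits the
origin: it need not be continuous, but the quasi-triangle inequality and its continuity at the
origin bound it below near every point `y ≠ 0`. -/
theorem IsHomogeneousQuasiNorm.exists_pos_le_of_isCompact {n : ℕ} (hn : 0 < n)
    {B : (Matrix (Fin n) (Fin n) ℝ)ˣ} (hB : IsAnisotropicDilation B.val)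
    {ρ : (Fin n → ℝ) → ℝ} (hρ : IsHomogeneousQuasiNorm B.val ρ) {s : Set (Fin n → ℝ)}
    (hs : IsCompact s) (h0 : 0 ∉ s) : ∃ c : ℝ, 0 < c ∧ ∀ x ∈ s, c ≤ ρ x := by
  obtain ⟨c, hc, hadd⟩ := hρ.quasi_triangle
  refine hs.induction_on (p := fun s => ∃ c : ℝ, 0 < c ∧ ∀ x ∈ s, c ≤ ρ x)
    ⟨1, one_pos, by simp⟩ ?_ ?_ fun y hy => ?_
  · rintro s t hst ⟨c, hc, h⟩
    exact ⟨c, hc, fun x hx => h x (hst hx)⟩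
  · rintro s t ⟨c, hc, h⟩ ⟨d, hd, h'⟩
    refine ⟨min c d, lt_min hc hd, fun x hx => ?_⟩
    rcases hx with hx | hx
    · exact (min_le_left _ _).trans (h x hx)
    · exact (min_le_right _ _).trans (h' x hx)
  · have hy0 : y ≠ 0 := fun h => h0 (h ▸ hy)
    have hρy : 0 < ρ y := (hρ.nonneg y).lt_of_ne fun h => hy0 ((hρ.eq_zero_iff y).1 h.symm)
    have hη : 0 < ρ y / (2 * c) := by positivity
    have hlim : Tendsto (fun z => y - z) (𝓝 y) (𝓝 0) := by
      have : Continuous fun z : Fin n → ℝ => y - z := by fun_prop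
      simpa using this.tendsto y
    refine ⟨_, mem_nhdsWithin_of_mem_nhds (hlim.eventually (hρ.eventually_lt hn hB hη)),
      _, hη, fun z hz => ?_⟩
    have h1 := hadd (y - z) z
    rw [sub_add_cancel] at h1
    have h2 : ρ (y - z) < ρ y / (2 * c) := hz
    have h3 : c * (ρ y / (2 * c)) = ρ y / 2 := by field_simp
    have h4 : c * ρ (y - z) < ρ y / 2 := by
      rw [← h3]
      gcongr
    have h5 : c * (ρ y / (2 * c)) < c * ρ z := by
      rw [h3]
      linarith
    exact (lt_of_mul_lt_mul_left h5 hc.le).le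

theorem norm_le_norm_inv_mul_norm_mulVec {n : ℕ} (Z : (Matrix (Fin n) (Fin n) ℝ)ˣ)
    (x : Fin n → ℝ) : ‖x‖ ≤ ‖Z⁻¹.val‖ * ‖Z.val.mulVec x‖ := by
  have h := Matrix.linfty_opNorm_mulVec Z⁻¹.val (Z.val.mulVec x)
  rwa [Matrix.mulVec_mulVec, ← Units.val_mul, inv_mul_cancel, Units.val_one,
    Matrix.one_mulVec] at h

theorem norm_val_pos {n : ℕ} (hn : 0 < n) (B : (Matrix (Fin n) (Fin n) ℝ)ˣ) : 0 < ‖B.val‖ := by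
  have : Nonempty (Fin n) := ⟨⟨0, hn⟩⟩
  exact norm_pos_iff.2 B.ne_zero

/-- A power of the dilation brings any nonzero vector into the shell `‖B‖⁻¹ ≤ ‖y‖ ≤ 1`. The
exponent `k` is the least one such that `‖B ^ (-j) x‖ ≤ 1` for all `j ≥ k`, which makes it
nonnegative when `1 < ‖x‖`. -/
theorem IsAnisotropicDilation.exists_zpow_mulVec_eq {n : ℕ} (hn : 0 < n)
    {B : (Matrix (Fin n) (Fin n) ℝ)ˣ} (hB : IsAnisotropicDilation B.val)
    {x : Fin n → ℝ} (hx : x ≠ 0) :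
    ∃ (k : ℤ) (y : Fin n → ℝ), x = (B ^ k).val.mulVec y ∧ ‖B.val‖⁻¹ ≤ ‖y‖ ∧ ‖y‖ ≤ 1 ∧
      (1 < ‖x‖ → 0 ≤ k) := by
  have hx0 : 0 < ‖x‖ := norm_pos_iff.2 hx
  have hBpos := norm_val_pos hn B
  let S : ℤ → Prop := fun k => ∀ j ≥ k, ‖(B ^ (-j)).val.mulVec x‖ ≤ 1
  obtain ⟨N₁, hN₁⟩ := hB.exists_norm_inv_pow_lt hx0
  obtain ⟨N₂, hN₂⟩ := hB.exists_norm_inv_pow_lt (inv_pos.2 hx0)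
  have hne : ∃ k, S k := by
    refine ⟨N₂, fun j hj => ?_⟩
    lift j to ℕ using by omega
    refine (Matrix.linfty_opNorm_mulVec _ _).trans ?_
    have := hN₂ j (by omega)
    rw [zpow_neg, zpow_natCast, ← inv_pow]
    calc _ ≤ ‖x‖⁻¹ * ‖x‖ := by gcongr
      _ = 1 := inv_mul_cancel₀ hx0.ne'
  have hbdd : ∀ k, S k → -(N₁ : ℤ) ≤ k := by
    intro k hk
    by_contra! hlt
    have h1 := hk (-(N₁ : ℤ)) hlt.le
    have h2 := norm_le_norm_inv_mul_norm_mulVec (B ^ N₁) x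
    rw [neg_neg, zpow_natCast] at h1
    rw [← inv_pow] at h2
    have h3 := hN₁ N₁ le_rfl
    have h4 : ‖(B⁻¹ ^ N₁).val‖ * ‖(B ^ N₁).val.mulVec x‖ ≤ ‖(B⁻¹ ^ N₁).val‖ * 1 := by gcongr
    linarith
  obtain ⟨k, hk, hmin⟩ := Int.exists_least_of_bdd ⟨_, hbdd⟩ hne
  refine ⟨k, (B ^ (-k)).val.mulVec x, ?_, ?_, hk k le_rfl, fun h1 => ?_⟩
  · rw [Matrix.mulVec_mulVec, ← Units.val_mul, zpow_neg, mul_inv_cancel, Units.val_one,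
      Matrix.one_mulVec]
  · have h1 : ¬ S (k - 1) := fun h => by
      have := hmin _ h
      omega
    simp only [S, not_forall, not_le] at h1
    obtain ⟨j, hj, hj1⟩ := h1
    have hjk : j = k - 1 := by
      by_contra hne
      exact absurd (hk j (by omega)) (not_le.2 hj1)
    have h2 : B ^ (-j) = B * B ^ (-k) := by
      rw [hjk, ← zpow_one_add]
      congr 1
      ring
    rw [h2, Units.val_mul, ← Matrix.mulVec_mulVec] at hj1
    have h3 := hj1.le.trans (Matrix.linfty_opNorm_mulVec _ _)
    rwa [inv_le_iff_one_le_mul₀' hBpos]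
  · by_contra! hlt
    have := hk 0 hlt.le
    rw [neg_zero, zpow_zero, Units.val_one, Matrix.one_mulVec] at this
    linarith

theorem IsHomogeneousQuasiNorm.exists_pos_le_of_le_norm {n : ℕ} (hn : 0 < n)
    {B : (Matrix (Fin n) (Fin n) ℝ)ˣ} (hB : IsAnisotropicDilation B.val)
    {ρ : (Fin n → ℝ) → ℝ} (hρ : IsHomogeneousQuasiNorm B.val ρ) {r : ℝ} (hr : 0 < r) :
    ∃ c : ℝ, 0 < c ∧ ∀ x, r ≤ ‖x‖ → c ≤ ρ x := by
  have hBpos := norm_val_pos hn B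
  have hq : 0 < min r ‖B.val‖⁻¹ := lt_min hr (inv_pos.2 hBpos)
  have hcomp : IsCompact {x : Fin n → ℝ | min r ‖B.val‖⁻¹ ≤ ‖x‖ ∧ ‖x‖ ≤ 1} := by
    refine (isCompact_closedBall (0 : Fin n → ℝ) 1).of_isClosed_subset ?_ fun x hx => ?_
    · exact (isClosed_le continuous_const continuous_norm).inter
        (isClosed_le continuous_norm continuous_const)
    · simpa using hx.2
  obtain ⟨c, hc, h⟩ := hρ.exists_pos_le_of_isCompact hn hB hcomp (by
    simp only [Set.mem_ofPred_eq, norm_zero, not_and]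
    intro h
    linarith)
  refine ⟨c, hc, fun x hx => ?_⟩
  rcases le_or_gt ‖x‖ 1 with h1 | h1
  · exact h x ⟨(min_le_left _ _).trans hx, h1⟩
  · obtain ⟨k, y, rfl, hy1, hy2, hk⟩ :=
      hB.exists_zpow_mulVec_eq hn (norm_pos_iff.1 (hr.trans_le hx))
    rw [hρ.apply_zpow_mulVec]
    have h2 := h y ⟨(min_le_right _ _).trans hy1, hy2⟩
    have h3 : (1 : ℝ) ≤ |B.val.det| ^ k := one_le_zpow₀ (hB.one_lt_abs_det hn).le (hk h1)
    exact h2.trans (le_mul_of_one_le_left (hρ.nonneg y) h3)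

/-- Sublevel sets of a quasi-norm are bounded. -/
theorem IsHomogeneousQuasiNorm.exists_norm_le_of_le {n : ℕ} (hn : 0 < n)
    {B : (Matrix (Fin n) (Fin n) ℝ)ˣ} (hB : IsAnisotropicDilation B.val)
    {ρ : (Fin n → ℝ) → ℝ} (hρ : IsHomogeneousQuasiNorm B.val ρ) (M : ℝ) :
    ∃ R : ℝ, ∀ x, ρ x ≤ M → ‖x‖ ≤ R := by
  obtain ⟨c, hc, h⟩ := hρ.exists_pos_le_of_le_norm hn hB one_pos
  obtain ⟨k, hk⟩ := pow_unbounded_of_one_lt (M / c) (hB.one_lt_abs_det hn)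
  refine ⟨‖(B ^ (k : ℤ)).val‖, fun x hx => ?_⟩
  have h1 := norm_le_norm_inv_mul_norm_mulVec (B ^ (-(k : ℤ))) x
  rw [← zpow_neg, neg_neg] at h1
  refine h1.trans (mul_le_of_le_one_right (norm_nonneg _) ?_)
  by_contra! hlt
  have h2 := h _ hlt.le
  rw [hρ.apply_zpow_mulVec, zpow_neg, zpow_natCast] at h2
  have hb : 0 < |B.val.det| ^ k := pow_pos (zero_lt_one.trans (hB.one_lt_abs_det hn)) k
  rw [div_lt_iff₀ hc] at hk
  rw [le_inv_mul_iff₀ hb] at h2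
  linarith

/-! ### Comparing quasi-norms of two dilations -/

/-- If every power of `B₁` agrees with a power of `B₂` of comparable determinant, up to a factor
that is bounded together with its inverse, then all quasi-norms of `B₁` and `B₂` are
equivalent. -/
theorem quasiNormsEquivalent_of_zpow_eq {n : ℕ} (hn : 0 < n)
    {B₁ B₂ : (Matrix (Fin n) (Fin n) ℝ)ˣ} (hB₁ : IsAnisotropicDilation B₁.val)
    (hB₂ : IsAnisotropicDilation B₂.val) (R : ℝ)
    (h : ∀ k : ℤ, ∃ (m : ℤ) (Z : (Matrix (Fin n) (Fin n) ℝ)ˣ), B₁ ^ k = B₂ ^ m * Z ∧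
      ‖Z.val‖ ≤ R ∧ ‖Z⁻¹.val‖ ≤ R ∧ |B₁.val.det| ^ k ≤ R * |B₂.val.det| ^ m ∧
      |B₂.val.det| ^ m ≤ R * |B₁.val.det| ^ k)
    {ρ₁ ρ₂ : (Fin n → ℝ) → ℝ} (hρ₁ : IsHomogeneousQuasiNorm B₁.val ρ₁)
    (hρ₂ : IsHomogeneousQuasiNorm B₂.val ρ₂) : QuasiNormsEquivalent ρ₁ ρ₂ := by
  have hR : 0 < R := by
    obtain ⟨m, Z, -, hZ, -⟩ := h 0
    exact (norm_val_pos hn Z).trans_le hZ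
  have hBpos := norm_val_pos hn B₁
  obtain ⟨c₁, hc₁, hlow₁⟩ := hρ₁.exists_pos_le_of_le_norm hn hB₁ (inv_pos.2 hBpos)
  obtain ⟨M₁, hM₁, hup₁⟩ := hρ₁.exists_le_of_norm_le hB₁ 1
  obtain ⟨c₂, hc₂, hlow₂⟩ := hρ₂.exists_pos_le_of_le_norm hn hB₂
    (div_pos (inv_pos.2 hBpos) hR)
  obtain ⟨M₂, hM₂, hup₂⟩ := hρ₂.exists_le_of_norm_le hB₂ R
  have key : ∀ x, ρ₁ x ≤ R * M₁ / c₂ * ρ₂ x ∧ ρ₂ x ≤ R * M₂ / c₁ * ρ₁ x := by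
    intro x
    by_cases hx : x = 0
    · rw [(hρ₁.eq_zero_iff x).2 hx, (hρ₂.eq_zero_iff x).2 hx]
      simp
    obtain ⟨k, y, rfl, hy1, hy2, -⟩ := hB₁.exists_zpow_mulVec_eq hn hx
    obtain ⟨m, Z, hZ, hZ1, hZ2, hd1, hd2⟩ := h k
    have e1 : ρ₁ ((B₁ ^ k).val.mulVec y) = |B₁.val.det| ^ k * ρ₁ y := hρ₁.apply_zpow_mulVec k y
    have e2 : ρ₂ ((B₁ ^ k).val.mulVec y) = |B₂.val.det| ^ m * ρ₂ (Z.val.mulVec y) := by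
      rw [hZ, Units.val_mul, ← Matrix.mulVec_mulVec, hρ₂.apply_zpow_mulVec]
    have hZy1 : ‖Z.val.mulVec y‖ ≤ R := by
      refine (Matrix.linfty_opNorm_mulVec _ _).trans ?_
      calc _ ≤ R * 1 := by gcongr
        _ = R := mul_one R
    have hZy2 : ‖B₁.val‖⁻¹ / R ≤ ‖Z.val.mulVec y‖ := by
      rw [div_le_iff₀' hR]
      refine hy1.trans ((norm_le_norm_inv_mul_norm_mulVec Z y).trans ?_)
      gcongr
    have l1 := hlow₁ y hy1
    have u1 := hup₁ y hy2
    have l2 := hlow₂ _ hZy2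
    have u2 := hup₂ _ hZy1
    have n1 := hρ₁.nonneg y
    have n2 := hρ₂.nonneg (Z.val.mulVec y)
    have p1 : 0 ≤ |B₁.val.det| ^ k := by positivity
    have p2 : 0 ≤ |B₂.val.det| ^ m := by positivity
    rw [e1, e2]
    constructor
    · calc |B₁.val.det| ^ k * ρ₁ y ≤ (R * |B₂.val.det| ^ m) * M₁ := by gcongr
        _ = R * M₁ / c₂ * (|B₂.val.det| ^ m * c₂) := by field_simp
        _ ≤ _ := by gcongr
    · calc |B₂.val.det| ^ m * ρ₂ (Z.val.mulVec y) ≤ (R * |B₁.val.det| ^ k) * M₂ := by gcongr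
        _ = R * M₂ / c₁ * (|B₁.val.det| ^ k * c₁) := by field_simp
        _ ≤ _ := by gcongr
  have hC : 0 < max (R * M₁ / c₂) (R * M₂ / c₁) := lt_max_of_lt_left (by positivity)
  refine ⟨_, hC, fun x => ⟨?_, (key x).2.trans ?_⟩⟩
  · rw [one_div, inv_mul_le_iff₀ hC]
    refine (key x).1.trans ?_
    have := hρ₂.nonneg x
    gcongr
    exact le_max_left _ _
  · have := hρ₁.nonneg x
    gcongr
    exact le_max_right _ _

theorem QuasiNormsEquivalent.symm {n : ℕ} {ρ₁ ρ₂ : (Fin n → ℝ) → ℝ}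
    (h : QuasiNormsEquivalent ρ₁ ρ₂) : QuasiNormsEquivalent ρ₂ ρ₁ := by
  obtain ⟨C, hC, h⟩ := h
  refine ⟨C, hC, fun x => ?_⟩
  have h1 := (h x).1
  have h2 := (h x).2
  rw [one_div, inv_mul_le_iff₀ hC] at h1 ⊢
  exact ⟨h2, h1⟩

theorem QuasiNormsEquivalent.trans {n : ℕ} {ρ₁ ρ₂ ρ₃ : (Fin n → ℝ) → ℝ}
    (h : QuasiNormsEquivalent ρ₁ ρ₂) (h' : QuasiNormsEquivalent ρ₂ ρ₃) :
    QuasiNormsEquivalent ρ₁ ρ₃ := by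
  obtain ⟨C, hC, h⟩ := h
  obtain ⟨D, hD, h'⟩ := h'
  refine ⟨D * C, by positivity, fun x => ?_⟩
  have h1 := (h x).1
  have h3 := (h' x).1
  rw [one_div, inv_mul_le_iff₀ (by positivity)] at h1 h3 ⊢
  constructor
  · calc ρ₁ x ≤ C * (D * ρ₃ x) := h1.trans (by gcongr)
      _ = D * C * ρ₃ x := by ring
  · calc ρ₃ x ≤ D * (C * ρ₁ x) := (h' x).2.trans (by gcongr; exact (h x).2)
      _ = D * C * ρ₁ x := by ring

/-! ### Rigidity of one-parameter groups with real spectrum -/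

theorem eq_one_of_zpow_le {r C : ℝ} (hr : 0 < r) (h : ∀ k : ℤ, r ^ k ≤ C) : r = 1 := by
  have aux : ∀ {q : ℝ}, (∀ k : ℕ, q ^ k ≤ C) → q ≤ 1 := by
    intro q hq
    by_contra! h1
    obtain ⟨k, hk⟩ := pow_unbounded_of_one_lt C h1
    exact absurd (hq k) (not_le.2 hk)
  refine le_antisymm (aux fun k => by simpa using h k) ?_
  have : r⁻¹ ≤ 1 := aux fun k => by simpa using h (-k)
  exact (inv_le_one₀ hr).1 this

theorem exists_common_eigenvector {V : Type*} [AddCommGroup V] [Module ℂ V]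
    [FiniteDimensional ℂ V] {f g : Module.End ℂ V} (hfg : Commute f g) {μ : ℂ} {v : V}
    (hv : v ≠ 0) (hμ : f v = μ • v) : ∃ (ν : ℂ) (w : V), w ≠ 0 ∧ f w = μ • w ∧ g w = ν • w := by
  have hinv : ∀ x ∈ Module.End.eigenspace f μ, g x ∈ Module.End.eigenspace f μ := by
    intro x hx
    rw [Module.End.mem_eigenspace_iff] at hx ⊢
    have := LinearMap.congr_fun hfg.eq x
    simp only [Module.End.mul_apply] at this
    rw [this, hx, map_smul]
  have : Nontrivial (Module.End.eigenspace f μ) :=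
    ⟨⟨⟨v, Module.End.mem_eigenspace_iff.2 hμ⟩, 0, fun h => hv (congrArg Subtype.val h)⟩⟩
  obtain ⟨ν, hν⟩ := Module.End.exists_eigenvalue (g.restrict hinv)
  obtain ⟨w, hw⟩ := hν.exists_hasEigenvector
  refine ⟨ν, w, fun h => hw.2 (Subtype.ext h), Module.End.mem_eigenspace_iff.1 w.2, ?_⟩
  exact congrArg Subtype.val hw.apply_eq_smul

theorem exp_smul_one {𝔸 : Type*} [NormedRing 𝔸] [NormedAlgebra ℂ 𝔸] [CompleteSpace 𝔸]
    (z : ℂ) : NormedSpace.exp (z • (1 : 𝔸)) = Complex.exp z • 1 := by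
  have := NormedSpace.algebraMap_exp_comm (𝕂 := ℂ) (𝔸 := 𝔸) z
  rw [Algebra.algebraMap_eq_smul_one, Algebra.algebraMap_eq_smul_one] at this
  rw [← this, Complex.exp_eq_exp_ℂ]

/-- If `Y P' - P Y = μ Y` with `Y ≠ 0`, then `μ` is the difference of an eigenvalue of `P'` and an
eigenvalue of `P`; in particular it is real when both spectra are real. -/
theorem im_eq_zero_of_mul_sub_mul_eq {𝔸 : Type*} [Ring 𝔸] [Algebra ℂ 𝔸]
    [FiniteDimensional ℂ 𝔸] {P P' Y : 𝔸}
    (hP : ∀ z ∈ spectrum ℂ P, z.im = 0) (hP' : ∀ z ∈ spectrum ℂ P', z.im = 0) {μ : ℂ}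
    (hY : Y ≠ 0) (h : Y * P' - P * Y = μ • Y) : μ.im = 0 := by
  have hcomm : Commute (LinearMap.mulRight ℂ P' - LinearMap.mulLeft ℂ P)
      (LinearMap.mulLeft ℂ P) := by
    refine LinearMap.ext fun X => ?_
    simp [mul_sub, mul_assoc]
  obtain ⟨ν, Z, hZ, h1, h2⟩ := exists_common_eigenvector hcomm hY (by simpa using h)
  simp only [LinearMap.sub_apply, LinearMap.mulRight_apply, LinearMap.mulLeft_apply] at h1 h2
  have hν : ν ∈ spectrum ℂ P := by
    intro hu
    refine hZ ((hu.mul_right_eq_zero).1 ?_)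
    rw [sub_mul, h2, Algebra.algebraMap_eq_smul_one, smul_mul_assoc, one_mul, sub_self]
  have hν' : μ + ν ∈ spectrum ℂ P' := by
    intro hu
    refine hZ ((hu.mul_left_eq_zero).1 ?_)
    rw [mul_sub, Algebra.algebraMap_eq_smul_one, mul_smul_comm, mul_one, add_smul, ← h1, ← h2]
    abel
  have e1 := hP _ hν
  have e2 := hP' _ hν'
  rw [Complex.add_im, e1, add_zero] at e2
  exact e2

theorem exp_neg_mul_mul_exp_eq_exp_smul {𝔸 : Type*} [NormedRing 𝔸] [NormedAlgebra ℂ 𝔸]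
    [CompleteSpace 𝔸] {P P' Y : 𝔸} {μ : ℂ}
    (h : Y * P' - P * Y = μ • Y) (s : ℝ) :
    NormedSpace.exp (s • (-P)) * Y * NormedSpace.exp (s • P') = Complex.exp (s * μ) • Y := by
  let : NormedAlgebra ℚ 𝔸 := NormedAlgebra.restrictScalars ℚ ℂ 𝔸
  have h1 : SemiconjBy Y (s • P') (s • P + ((s : ℂ) * μ) • 1) := by
    have : Y * P' = P * Y + μ • Y := by rw [← h]; abel
    rw [SemiconjBy, mul_smul_comm, this, add_mul, smul_mul_assoc, smul_mul_assoc, one_mul,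
      smul_add, mul_smul, Complex.coe_smul]
  have h2 := h1.exp_right.eq
  rw [NormedSpace.exp_add_of_commute ((Commute.one_right _).smul_right _), exp_smul_one] at h2
  rw [mul_assoc, h2, ← mul_assoc, ← mul_assoc, ← NormedSpace.exp_add_of_commute
    (((Commute.refl P).neg_left.smul_left s).smul_right s), smul_neg, neg_add_cancel,
    NormedSpace.exp_zero]
  simp

theorem exp_neg_mul_mul_exp_eq_add {𝔸 : Type*} [NormedRing 𝔸] [NormedAlgebra ℂ 𝔸]
    [CompleteSpace 𝔸] {P P' X Y : 𝔸}
    (hX : X * P' - P * X = Y) (hY : Y * P' - P * Y = 0) (s : ℝ) :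
    NormedSpace.exp (s • (-P)) * X * NormedSpace.exp (s • P') = X + s • Y := by
  let g : ℝ → 𝔸 := fun s =>
    NormedSpace.exp (s • (-P)) * X * NormedSpace.exp (s • P') - s • Y
  have hg : ∀ s, HasDerivAt g 0 s := by
    intro s
    have h1 := ((hasDerivAt_exp_smul_const (𝕂 := ℝ) (-P) s).mul_const X).mul
      (hasDerivAt_exp_smul_const' (𝕂 := ℝ) P' s)
    have h2 := h1.sub ((hasDerivAt_id s).smul_const Y)
    convert! h2 using 1
    have h3 := exp_neg_mul_mul_exp_eq_exp_smul (μ := 0) (by rw [hY, zero_smul]) s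
    rw [mul_zero, Complex.exp_zero, one_smul] at h3
    rw [one_smul, eq_comm, sub_eq_zero]
    conv_rhs => rw [← h3, ← hX]
    simp only [mul_neg, neg_mul, mul_sub, sub_mul, mul_assoc]
    abel
  have h := is_const_of_deriv_eq_zero (fun s => (hg s).differentiableAt) (fun s => (hg s).deriv) s 0
  simp only [g, zero_smul, NormedSpace.exp_zero, one_mul, mul_one, sub_zero] at h
  exact sub_eq_iff_eq_add.1 h

/-- Two matrices with real spectra are equal if `exp (-k τ P) exp (k τ P')` stays bounded for
`k : ℤ`. The matrices `X` for which `exp (-k τ P) X exp (k τ P')` stays bounded form a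
subspace that is invariant under `T X = X P' - P X`. If `T` did not vanish there, its range would
contain an eigenvector `Y = T X`; the eigenvalue is real, so boundedness makes it `0`,
and then the orbit `X + k τ Y` of `X` is unbounded. Hence `P' - P = T 1 = 0`. -/
theorem eq_of_norm_exp_neg_mul_exp_le {𝔸 : Type*} [NormedRing 𝔸] [NormedAlgebra ℂ 𝔸]
    [FiniteDimensional ℂ 𝔸] {P P' : 𝔸}
    (hP : ∀ z ∈ spectrum ℂ P, z.im = 0) (hP' : ∀ z ∈ spectrum ℂ P', z.im = 0) {τ : ℝ}
    (hτ : 0 < τ) {C : ℝ} (hC : ∀ k : ℤ, ‖NormedSpace.exp ((k * τ) • (-P)) *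
      NormedSpace.exp ((k * τ) • P')‖ ≤ C) : P = P' := by
  let : NormedAlgebra ℚ 𝔸 := NormedAlgebra.restrictScalars ℚ ℂ 𝔸
  have : CompleteSpace 𝔸 := FiniteDimensional.complete ℂ 𝔸
  let W : Submodule ℂ 𝔸 :=
    { carrier := {X | ∃ C, ∀ k : ℤ, ‖NormedSpace.exp ((k * τ) • (-P)) * X *
        NormedSpace.exp ((k * τ) • P')‖ ≤ C}
      zero_mem' := ⟨0, by simp⟩
      add_mem' := by
        rintro X Y ⟨C, hC⟩ ⟨D, hD⟩
        refine ⟨C + D, fun k => ?_⟩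
        rw [mul_add, add_mul]
        exact (norm_add_le _ _).trans (add_le_add (hC k) (hD k))
      smul_mem' := by
        rintro c X ⟨C, hC⟩
        refine ⟨‖c‖ * C, fun k => ?_⟩
        rw [mul_smul_comm, smul_mul_assoc, norm_smul]
        gcongr
        exact hC k }
  let T : Module.End ℂ 𝔸 := LinearMap.mulRight ℂ P' - LinearMap.mulLeft ℂ P
  have hT : ∀ X, T X = X * P' - P * X := fun X => rfl
  have hTW : ∀ X ∈ W, T X ∈ W := by
    rintro X ⟨C, hC⟩
    refine ⟨C * ‖P'‖ + ‖P‖ * C, fun k => ?_⟩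
    have c1 : Commute P (NormedSpace.exp ((k * τ) • (-P))) :=
      ((Commute.refl P).neg_right.smul_right _).exp_right
    have c2 : Commute P' (NormedSpace.exp ((k * τ) • P')) :=
      ((Commute.refl P').smul_right _).exp_right
    have e : NormedSpace.exp ((k * τ) • (-P)) * T X * NormedSpace.exp ((k * τ) • P') =
        NormedSpace.exp ((k * τ) • (-P)) * X * NormedSpace.exp ((k * τ) • P') * P' -
        P * (NormedSpace.exp ((k * τ) • (-P)) * X * NormedSpace.exp ((k * τ) • P')) := by
      rw [hT, mul_sub, sub_mul, mul_assoc _ _ P', ← c2.eq, ← mul_assoc _ P X, ← c1.eq]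
      simp only [mul_assoc]
    rw [e]
    refine (norm_sub_le _ _).trans (add_le_add ?_ ?_)
    · exact (norm_mul_le _ _).trans (by gcongr; exact hC k)
    · exact (norm_mul_le _ _).trans (by gcongr; exact hC k)
  have h1W : (1 : 𝔸) ∈ W := ⟨C, fun k => by simpa using hC k⟩
  by_contra hne
  have hT1 : T 1 ≠ 0 := by
    rw [hT, one_mul, mul_one]
    exact sub_ne_zero.2 (Ne.symm hne)
  let W₁ := W.map T
  have hTW₁ : ∀ X ∈ W₁, T X ∈ W₁ := by
    rintro _ ⟨X, hX, rfl⟩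
    exact ⟨T X, hTW X hX, rfl⟩
  have : Nontrivial W₁ := ⟨⟨⟨T 1, 1, h1W, rfl⟩, 0, fun h => hT1 (congrArg Subtype.val h)⟩⟩
  obtain ⟨μ, hμ⟩ := Module.End.exists_eigenvalue (T.restrict hTW₁)
  obtain ⟨⟨Y, X, hX, hXY⟩, hY⟩ := hμ.exists_hasEigenvector
  have hY0 : Y ≠ 0 := fun h => hY.2 (Subtype.ext h)
  have hTY : Y * P' - P * Y = μ • Y := congrArg Subtype.val hY.apply_eq_smul
  have him := im_eq_zero_of_mul_sub_mul_eq hP hP' hY0 hTY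
  have hYpos : 0 < ‖Y‖ := norm_pos_iff.2 hY0
  have hμ0 : μ = 0 := by
    obtain ⟨D, hD⟩ := hXY ▸ hTW X hX
    have : Real.exp (τ * μ.re) = 1 := by
      refine eq_one_of_zpow_le (C := D / ‖Y‖) (Real.exp_pos _) fun k => ?_
      have h := hD k
      rw [exp_neg_mul_mul_exp_eq_exp_smul hTY, norm_smul, Complex.norm_exp] at h
      rw [le_div_iff₀ hYpos, ← Real.rpow_intCast, ← Real.exp_mul]
      have e : (((k * τ : ℝ) : ℂ) * μ).re = τ * μ.re * k := by
        rw [Complex.re_ofReal_mul]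
        ring
      rwa [e] at h
    rw [Real.exp_eq_one_iff] at this
    exact Complex.ext (by simpa [hτ.ne'] using this) him
  rw [hμ0, zero_smul] at hTY
  obtain ⟨D, hD⟩ := hX
  obtain ⟨k, hk⟩ := exists_nat_gt ((D + ‖X‖) / (τ * ‖Y‖))
  rw [div_lt_iff₀ (by positivity)] at hk
  have h := hD k
  rw [exp_neg_mul_mul_exp_eq_add hXY hTY] at h
  have h2 : ‖((k : ℤ) * τ : ℝ) • Y‖ ≤ ‖X + ((k : ℤ) * τ : ℝ) • Y‖ + ‖X‖ := by
    have := norm_sub_le (X + ((k : ℤ) * τ : ℝ) • Y) X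
    rwa [add_sub_cancel_left] at this
  rw [norm_smul, Real.norm_of_nonneg (by positivity)] at h2
  simp only [Int.cast_natCast] at h2 h
  nlinarith

/-! ### Logarithms of unipotent elements -/

/-- Every unipotent element `1 + R` is the exponential of a nilpotent `L` that commutes with the
commutant of `R`. Newton's iteration: `exp (-R) * (1 + R) = 1 + R'` with `R'` divisible by `R ^ 2`,
so that `L = R + L'` for the logarithm `L'` of `1 + R'`. -/
theorem exists_isNilpotent_exp_eq_one_add {𝔸 : Type*} [NormedRing 𝔸] [NormedAlgebra ℝ 𝔸]
    [CompleteSpace 𝔸] {R : 𝔸} {d : ℕ} (hR : R ^ (2 ^ d) = 0) :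
    ∃ L : 𝔸, IsNilpotent L ∧ (∀ X, Commute X R → Commute X L) ∧ NormedSpace.exp L = 1 + R := by
  let : NormedAlgebra ℚ 𝔸 := NormedAlgebra.restrictScalars ℚ ℝ 𝔸
  induction d generalizing R with
  | zero =>
    obtain rfl : R = 0 := by simpa using hR
    exact ⟨0, IsNilpotent.zero, fun X _ => Commute.zero_right X, by simp⟩
  | succ d ih =>
    let g : ℕ → 𝔸 := fun k => ((k + 2).factorial⁻¹ : ℝ) • R ^ k
    have hg : Summable g := by
      refine summable_of_ne_finset_zero (s := Finset.range (2 ^ (d + 1))) fun k hk => ?_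
      rw [Finset.mem_range, not_lt] at hk
      simp [g, pow_eq_zero_of_le hk hR]
    have hexp : NormedSpace.exp R = 1 + R + R ^ 2 * ∑' k, g k := by
      rw [NormedSpace.exp_eq_tsum ℝ]
      have hs : Summable fun k : ℕ => (k.factorial⁻¹ : ℝ) • R ^ k :=
        (NormedSpace.exp_series_hasSum_exp' (𝕂 := ℝ) R).summable
      change ∑' k : ℕ, (k.factorial⁻¹ : ℝ) • R ^ k = _
      rw [← hs.sum_add_tsum_nat_add 2, ← hg.tsum_mul_left]
      congr 1
      · simp [Finset.sum_range_succ]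
      · refine tsum_congr fun k => ?_
        simp only [g]
        rw [mul_smul_comm, ← pow_add, add_comm 2 k]
    have hRg : Commute R (∑' k, g k) :=
      Commute.tsum_right R fun k => ((Commute.refl R).pow_right k).smul_right _
    have hRe : Commute R (NormedSpace.exp (-R)) := (Commute.refl R).neg_right.exp_right
    have hee : NormedSpace.exp (-R) * NormedSpace.exp R = 1 := by
      rw [← NormedSpace.exp_add_of_commute (Commute.refl R).neg_left, neg_add_cancel,
        NormedSpace.exp_zero]
    have hee' : NormedSpace.exp R * NormedSpace.exp (-R) = 1 := by
      rw [← NormedSpace.exp_add_of_commute (Commute.refl R).neg_right, add_neg_cancel,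
        NormedSpace.exp_zero]
    have hR' : NormedSpace.exp (-R) * (1 + R) - 1 =
        R ^ 2 * -(NormedSpace.exp (-R) * ∑' k, g k) := by
      have h1 : 1 + R = NormedSpace.exp R - R ^ 2 * ∑' k, g k := by
        rw [hexp, add_sub_cancel_right]
      rw [h1, mul_sub, hee, sub_sub_cancel_left, ← mul_assoc, ← (hRe.pow_left 2).eq, mul_assoc,
        mul_neg]
    obtain ⟨L, hL, hLcomm, hLexp⟩ := ih (R := NormedSpace.exp (-R) * (1 + R) - 1) (by
      rw [hR', ((hRe.mul_right hRg).neg_right.pow_left 2).mul_pow, ← pow_mul, ← pow_succ', hR,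
        zero_mul])
    have hcomm : ∀ X, Commute X R → Commute X (NormedSpace.exp (-R) * (1 + R) - 1) := fun X hX =>
      ((hX.neg_right.exp_right).mul_right ((Commute.one_right X).add_right hX)).sub_right
        (Commute.one_right X)
    have hRL : Commute R L := hLcomm R (hcomm R (Commute.refl R))
    refine ⟨R + L, hRL.isNilpotent_add ⟨_, hR⟩ hL,
      fun X hX => hX.add_right (hLcomm X (hcomm X hX)), ?_⟩
    rw [NormedSpace.exp_add_of_commute hRL, hLexp, add_sub_cancel, ← mul_assoc, hee', one_mul]

/-! ### Polynomial functional calculus of semisimple matrices -/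

open Polynomial in
/-- A real-valued function that is invariant under complex conjugation is interpolated on finitely
many complex nodes by a polynomial with real coefficients. -/
theorem exists_real_polynomial_aeval_eq (s : Finset ℂ) {f : ℂ → ℝ}
    (hf : ∀ z, f (starRingEnd ℂ z) = f z) : ∃ q : ℝ[X], ∀ z ∈ s, aeval z q = (f z : ℂ) := by
  classical
  -- The nodes are made invariant under conjugation, so that the interpolation polynomial is too.
  let t := s ∪ s.image (starRingEnd ℂ)
  have ht : ∀ z ∈ t, starRingEnd ℂ z ∈ t := by
    intro z hz
    simp only [t, Finset.mem_union, Finset.mem_image] at hz ⊢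
    rcases hz with h | ⟨w, hw, rfl⟩
    · exact Or.inr ⟨z, h, rfl⟩
    · exact Or.inl (by simpa using hw)
  let p : ℂ[X] := Lagrange.interpolate t id fun z => (f z : ℂ)
  have hinj : Set.InjOn (id : ℂ → ℂ) t := Function.injective_id.injOn
  have hp : ∀ z ∈ t, p.eval z = f z := fun z hz =>
    Lagrange.eval_interpolate_at_node (fun z => (f z : ℂ)) hinj hz
  have hconj : p.map (starRingEnd ℂ) = p := by
    refine Lagrange.eq_interpolate_of_eval_eq (fun z => (f z : ℂ)) hinj ?_ fun z hz => ?_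
    · exact (degree_map_le).trans_lt (Lagrange.degree_interpolate_lt _ hinj)
    · have h := congrArg (starRingEnd ℂ) (hp _ (ht z hz))
      rw [Complex.conj_ofReal, hf] at h
      rw [id, eval_map, ← h, ← coe_eval₂RingHom, ← eval₂_at_apply, Complex.conj_conj]
      rfl
  obtain ⟨q, hq⟩ : p ∈ lifts (algebraMap ℝ ℂ) := by
    refine (lifts_iff_coeff_lifts p).2 fun k => ?_
    have h := congrArg (fun r : ℂ[X] => r.coeff k) hconj
    simp only [coeff_map] at h
    obtain ⟨r, hr⟩ := Complex.conj_eq_iff_real.1 h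
    exact ⟨r, hr.symm⟩
  refine ⟨q, fun z hz => ?_⟩
  rw [← hp z (Finset.mem_union_left _ hz), ← hq]
  simp [aeval_def, eval_map]

open Polynomial in
/-- An element annihilated by a polynomial with simple roots has a resolution of the identity into
eigenprojections, given by the Lagrange basis. -/
theorem exists_sum_eq_one_of_aeval_nodal_eq_zero {𝔸 : Type*} [Ring 𝔸] [Algebra ℂ 𝔸] {a : 𝔸}
    {s : Finset ℂ} (ha : aeval a (Lagrange.nodal s id) = 0) :
    ∃ E : ℂ → 𝔸, ∑ z ∈ s, E z = 1 ∧ (∀ z ∈ s, ∀ p : ℂ[X], aeval a p * E z = p.eval z • E z) ∧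
      ∀ z, ∀ X, Commute X a → Commute X (E z) := by
  refine ⟨fun z => aeval a (Lagrange.basis s id z), ?_, fun z hz p => ?_, fun z X hX => ?_⟩
  · rcases s.eq_empty_or_nonempty with rfl | hs
    · simpa using ha.symm
    · rw [← map_sum, Lagrange.sum_basis Function.injective_id.injOn hs, map_one]
  · have h0 : (X - C z) ∣ p - C (p.eval z) := X_sub_C_dvd_sub_C_eval
    obtain ⟨r, hr⟩ := h0
    have h1 : p * Lagrange.basis s id z = C (p.eval z) * Lagrange.basis s id z +
        r * C (Lagrange.nodalWeight s id z) * Lagrange.nodal s id := by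
      have h2 : (X - C z) * Lagrange.basis s id z =
          C (Lagrange.nodalWeight s id z) * Lagrange.nodal s id := by
        rw [Lagrange.basis_eq_prod_sub_inv_mul_nodal_div hz, ← Lagrange.nodal_erase_eq_nodal_div hz,
          Lagrange.nodal_eq_mul_nodal_erase hz]
        simp only [id]
        ring
      linear_combination Lagrange.basis s id z * hr + r * h2
    rw [← map_mul, h1, map_add, map_mul, map_mul (aeval a) _ (Lagrange.nodal s id), ha, mul_zero,
      add_zero, aeval_C, Algebra.algebraMap_eq_smul_one, smul_mul_assoc, one_mul]
  · exact Algebra.commute_of_mem_adjoin_singleton_of_commute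
      (aeval_mem_adjoin_singleton ℂ a) hX

theorem eq_zero_of_isNilpotent_of_mulVec_eq_smul {n : ℕ} {N : Matrix (Fin n) (Fin n) ℂ}
    (hN : IsNilpotent N) {ν : ℂ} {w : Fin n → ℂ} (hw : w ≠ 0) (h : N.mulVec w = ν • w) : ν = 0 := by
  obtain ⟨k, hk⟩ := hN
  have hpow : ∀ k : ℕ, (N ^ k).mulVec w = ν ^ k • w := by
    intro k
    induction k with
    | zero => simp
    | succ k ih => rw [pow_succ, ← Matrix.mulVec_mulVec, h, Matrix.mulVec_smul, ih, smul_smul,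
        pow_succ']
  have h0 := hpow k
  rw [hk, Matrix.zero_mulVec] at h0
  have h1 := (smul_eq_zero.1 h0.symm).resolve_right hw
  by_contra hν
  exact pow_ne_zero k hν h1

open Polynomial in
theorem exists_isNilpotent_add_squarefree_minpoly {n : ℕ} (A : Matrix (Fin n) (Fin n) ℝ) :
    ∃ N S : Matrix (Fin n) (Fin n) ℝ, IsNilpotent N ∧ Squarefree (minpoly ℝ S) ∧ Commute N S ∧
      A = N + S := by
  let e : Matrix (Fin n) (Fin n) ℝ ≃ₐ[ℝ] Module.End ℝ (Fin n → ℝ) := Matrix.toLinAlgEquiv'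
  obtain ⟨N, hN, S, hS, hNn, hSs, h⟩ := (e A).exists_isNilpotent_isSemisimple
  have hNS : Commute N S := Algebra.commute_of_mem_adjoin_singleton_of_commute hS
    (Algebra.commute_of_mem_adjoin_self hN).symm
  refine ⟨e.symm N, e.symm S, hNn.map e.symm, ?_, hNS.map e.symm, ?_⟩
  · rw [minpoly.algEquiv_eq]
    exact hSs.minpoly_squarefree
  · rw [← map_add, ← h, AlgEquiv.symm_apply_apply]

/-! ### The positive part of a dilation -/

/-- Complexification of real matrices, as a homomorphism of real algebras. -/
noncomputable def complexify (n : ℕ) : Matrix (Fin n) (Fin n) ℝ →ₐ[ℝ] Matrix (Fin n) (Fin n) ℂ :=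
  (Algebra.ofId ℝ ℂ).mapMatrix

theorem complexify_apply {n : ℕ} (M : Matrix (Fin n) (Fin n) ℝ) :
    complexify n M = M.map (algebraMap ℝ ℂ) := rfl

theorem complexify_exp {n : ℕ} (M : Matrix (Fin n) (Fin n) ℝ) :
    complexify n (NormedSpace.exp M) = NormedSpace.exp (complexify n M) := by
  refine NormedSpace.map_exp (complexify n) ?_ M
  exact (complexify n).toLinearMap.continuous_of_finiteDimensional

theorem norm_complexify {n : ℕ} (M : Matrix (Fin n) (Fin n) ℝ) : ‖complexify n M‖ = ‖M‖ :=
  norm_map_algebraMap M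

theorem complexify_injective (n : ℕ) : Function.Injective (complexify n) := by
  refine (injective_iff_map_eq_zero _).2 fun M hM => ?_
  rw [← norm_eq_zero, ← norm_complexify, hM, norm_zero]

open Polynomial in
/-- The resolution into eigenprojections of the complexification of a real semisimple matrix. -/
theorem exists_eigenprojections {n : ℕ} {S : Matrix (Fin n) (Fin n) ℝ}
    (hS : Squarefree (minpoly ℝ S)) :
    ∃ (s : Finset ℂ) (E : ℂ → Matrix (Fin n) (Fin n) ℂ), ∑ z ∈ s, E z = 1 ∧
      (∀ z ∈ s, ∀ p : ℂ[X], aeval (complexify n S) p * E z = p.eval z • E z) ∧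
      ∀ z, ∀ X, Commute X (complexify n S) → Commute X (E z) := by
  classical
  let p := (minpoly ℝ S).map (algebraMap ℝ ℂ)
  have hsep : p.Separable := (PerfectField.separable_iff_squarefree.2 hS).map
  have hmonic : p.Monic := (minpoly.monic (Algebra.IsIntegral.isIntegral S)).map _
  have hp : Lagrange.nodal p.roots.toFinset id = p := by
    change (Multiset.map (fun z => X - C z) p.roots.toFinset.val).prod = p
    rw [Multiset.toFinset_val, (nodup_roots hsep).dedup]
    exact ((IsAlgClosed.splits p).eq_prod_roots_of_monic hmonic).symm
  have hzero : aeval (complexify n S) p = 0 := by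
    rw [aeval_map_algebraMap, aeval_algHom_apply, minpoly.aeval, map_zero]
  exact ⟨p.roots.toFinset, exists_sum_eq_one_of_aeval_nodal_eq_zero (by rw [hp, hzero])⟩

/-- A unit acting on the ranges of a resolution of the identity by scalars of modulus `1` has
bounded powers. -/
theorem exists_norm_zpow_le {n : ℕ} {s : Finset ℂ} {E : ℂ → Matrix (Fin n) (Fin n) ℂ}
    (hE : ∑ z ∈ s, E z = 1) (U : (Matrix (Fin n) (Fin n) ℂ)ˣ) {u : ℂ → ℂ}
    (hu : ∀ z ∈ s, E z ≠ 0 → ‖u z‖ = 1) (hU : ∀ z ∈ s, U.val * E z = u z • E z) :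
    ∃ C : ℝ, ∀ k : ℤ, ‖(U ^ k).val‖ ≤ C := by
  refine ⟨∑ z ∈ s, ‖E z‖, fun k => ?_⟩
  rw [← mul_one (U ^ k).val, ← hE, Finset.mul_sum]
  refine (norm_sum_le _ _).trans (Finset.sum_le_sum fun z hz => ?_)
  by_cases h0 : E z = 0
  · rw [h0, mul_zero]
  have hu0 : u z ≠ 0 := norm_ne_zero_iff.1 (by rw [hu z hz h0]; exact one_ne_zero)
  let c : (Matrix (Fin n) (Fin n) ℂ)ˣ :=
    Units.map (algebraMap ℂ (Matrix (Fin n) (Fin n) ℂ)).toMonoidHom (Units.mk0 (u z) hu0)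
  have hc : ∀ k : ℤ, (c ^ k).val = (u z) ^ k • (1 : Matrix (Fin n) (Fin n) ℂ) := by
    intro k
    rw [← Algebra.algebraMap_eq_smul_one]
    simp only [c]
    rw [← map_zpow, Units.coe_map, Units.val_zpow_eq_zpow_val, Units.val_mk0]
    rfl
  have h1 : SemiconjBy (E z) c.val U.val := by
    have := hc 1
    rw [zpow_one, zpow_one] at this
    rw [SemiconjBy, hU z hz, this, mul_smul_comm, mul_one]
  have h2 := (h1.units_zpow_right k).eq
  rw [hc, mul_smul_comm, mul_one] at h2
  rw [← h2, norm_smul, norm_zpow, hu z hz h0, one_zpow, one_mul]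

/-- The positive part of a dilation: `A = exp D * U`, where `D` has positive eigenvalues and `U`
commutes with `D` and has bounded powers. For the Jordan decomposition `A = N + S`, the matrix `D`
is the sum of the logarithm of the unipotent matrix `1 + S⁻¹ N` and of `q(S)`, where `q` is a real
polynomial with `q(z) = log ‖z‖` on the spectrum of `S`; then `U = exp (-q(S)) S` acts as
`z / ‖z‖` on the `z`-eigenspace of `S`. -/
theorem IsAnisotropicDilation.exists_exp_mul {n : ℕ} {A : (Matrix (Fin n) (Fin n) ℝ)ˣ}
    (hA : IsAnisotropicDilation A.val) :
    ∃ (D : Matrix (Fin n) (Fin n) ℝ) (U : (Matrix (Fin n) (Fin n) ℝ)ˣ),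
      A.val = NormedSpace.exp D * U.val ∧ Commute D U.val ∧ HasPositiveEigenvalues D ∧
      ∃ C : ℝ, ∀ k : ℤ, ‖(U ^ k).val‖ ≤ C := by
  obtain ⟨N, S, hN, hS, hNS, hAS⟩ := exists_isNilpotent_add_squarefree_minpoly A.val
  have hAN : Commute A.val N := by
    rw [hAS]
    exact (Commute.refl N).add_left hNS.symm
  have hSu : IsUnit S := by
    have h1 : S = A.val + -N := by rw [hAS]; abel
    rw [h1]
    exact IsNilpotent.isUnit_add_left_of_commute hN.neg A.isUnit hAN.neg_right.symm
  obtain ⟨s, E, hE1, hE, hEcomm⟩ := exists_eigenprojections hS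
  obtain ⟨q, hq⟩ := exists_real_polynomial_aeval_eq s (f := fun z => Real.log ‖z‖) (by simp)
  let H := Polynomial.aeval S q
  have hHcomm : ∀ X, Commute X S → Commute X H := fun X hX =>
    Algebra.commute_of_mem_adjoin_singleton_of_commute
      (Polynomial.aeval_mem_adjoin_singleton ℝ S) hX
  obtain ⟨Su, rfl⟩ := hSu
  have hSinv : ∀ X, Commute X Su.val → Commute X Su⁻¹.val := fun X hX => hX.units_inv_right
  have hM : IsNilpotent (Su⁻¹.val * N) := (hSinv N hNS).symm.isNilpotent_mul_left hN
  obtain ⟨d, hd⟩ : ∃ d : ℕ, (Su⁻¹.val * N) ^ (2 ^ d) = 0 := by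
    obtain ⟨d, hd⟩ := hM
    exact ⟨d, pow_eq_zero_of_le (Nat.lt_two_pow_self).le hd⟩
  obtain ⟨L, hL, hLcomm, hLexp⟩ := exists_isNilpotent_exp_eq_one_add hd
  replace hLexp : NormedSpace.exp L = 1 + Su⁻¹.val * N := hLexp
  have hLcomm' : ∀ X, Commute X Su.val → Commute X N → Commute X L := fun X h1 h2 =>
    hLcomm X ((hSinv X h1).mul_right h2)
  have hSL : Commute Su.val L := hLcomm' _ (Commute.refl _) hNS.symm
  have hSH : Commute Su.val H := hHcomm _ (Commute.refl _)
  have hLH : Commute L H := hHcomm L hSL.symm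
  have hASL : A.val = Su.val * NormedSpace.exp L := by
    rw [hLexp, mul_add, mul_one, ← mul_assoc, Units.mul_inv, one_mul, hAS, add_comm]
  have hexpH : NormedSpace.exp (-H) * NormedSpace.exp H = 1 := by
    rw [← Matrix.exp_add_of_commute _ _ (Commute.refl H).neg_left, neg_add_cancel,
      NormedSpace.exp_zero]
  have hexpH' : NormedSpace.exp H * NormedSpace.exp (-H) = 1 := by
    rw [← Matrix.exp_add_of_commute _ _ (Commute.refl H).neg_right, add_neg_cancel,
      NormedSpace.exp_zero]
  let Hu : (Matrix (Fin n) (Fin n) ℝ)ˣ := ⟨NormedSpace.exp (-H), NormedSpace.exp H, hexpH, hexpH'⟩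
  have hcommexp : ∀ X, Commute X H → Commute X (NormedSpace.exp (-H)) := fun X hX =>
    hX.neg_right.exp_right
  have hES : ∀ z ∈ s, complexify n Su.val * E z = z • E z := fun z hz => by
    simpa using hE z hz Polynomial.X
  have hEH : ∀ z ∈ s, complexify n H * E z = (Real.log ‖z‖ : ℂ) • E z := fun z hz => by
    have := hE z hz (q.map (algebraMap ℝ ℂ))
    rwa [Polynomial.aeval_map_algebraMap, Polynomial.aeval_algHom_apply, Polynomial.eval_map,
      ← Polynomial.aeval_def, hq z hz] at this
  -- An eigenvector of the semisimple part can be chosen to be one of `A` as well.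
  have hnorm : ∀ z ∈ s, ∀ v, (E z).mulVec v ≠ 0 → 1 < ‖z‖ := by
    intro z hz v hv
    have hcomm : Commute (Matrix.toLin' (complexify n Su.val)) (Matrix.toLin' (complexify n N)) :=
      (hNS.symm.map (complexify n)).map Matrix.toLinAlgEquiv'
    obtain ⟨ν, w, hw, h1, h2⟩ := exists_common_eigenvector hcomm hv (μ := z) (by
      rw [Matrix.toLin'_apply, Matrix.mulVec_mulVec, hES z hz, Matrix.smul_mulVec])
    rw [Matrix.toLin'_apply] at h1 h2
    rw [eq_zero_of_isNilpotent_of_mulVec_eq_smul (hN.map (complexify n)) hw h2, zero_smul] at h2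
    refine hA z ((isComplexEigenvalue_iff_exists_mulVec _ _).2 ⟨w, hw, ?_⟩)
    rw [← complexify_apply, hAS, map_add, Matrix.add_mulVec, h1, h2, zero_add]
  refine ⟨H + L, Hu * Su, ?_, ?_, ?_, ?_⟩
  · change _ = _ * (NormedSpace.exp (-H) * Su.val)
    rw [Matrix.exp_add_of_commute _ _ hLH.symm, hASL]
    have c1 : Commute (NormedSpace.exp L) (NormedSpace.exp (-H)) :=
      hcommexp _ (show Commute (NormedSpace.exp L) H from hLH.exp_left)
    have c2 : Commute (Su.val) (NormedSpace.exp L) := hSL.exp_right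
    rw [mul_assoc, ← mul_assoc (NormedSpace.exp L), c1.eq, mul_assoc, ← mul_assoc, hexpH', one_mul,
      c2.eq]
  · exact ((hcommexp _ (Commute.refl H)).mul_right hSH.symm).add_left
      ((hcommexp _ hLH).mul_right hSL.symm)
  · intro μ hμ
    obtain ⟨v, hv, hDv⟩ := (isComplexEigenvalue_iff_exists_mulVec _ _).1 hμ
    rw [← complexify_apply] at hDv
    obtain ⟨z, hz, hzv⟩ : ∃ z ∈ s, (E z).mulVec v ≠ 0 := by
      by_contra! h
      refine hv ?_
      rw [← Matrix.one_mulVec v, ← hE1, Matrix.sum_mulVec]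
      exact Finset.sum_eq_zero h
    have hDE : Commute (complexify n (H + L)) (E z) :=
      hEcomm z _ ((hSH.add_right hSL).symm.map (complexify n))
    have h1 : (complexify n (H + L)).mulVec ((E z).mulVec v) = μ • (E z).mulVec v := by
      rw [Matrix.mulVec_mulVec, hDE.eq, ← Matrix.mulVec_mulVec, hDv, Matrix.mulVec_smul]
    have h2 : (complexify n H).mulVec ((E z).mulVec v) =
        (Real.log ‖z‖ : ℂ) • (E z).mulVec v := by
      rw [Matrix.mulVec_mulVec, hEH z hz, Matrix.smul_mulVec]
    rw [map_add, Matrix.add_mulVec, h2] at h1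
    have h3 := eq_zero_of_isNilpotent_of_mulVec_eq_smul (hL.map (complexify n)) hzv
      (ν := μ - Real.log ‖z‖) (by rw [sub_smul, ← h1, add_sub_cancel_left])
    exact ⟨Real.log ‖z‖, Real.log_pos (hnorm z hz v hzv), sub_eq_zero.1 h3⟩
  · let φ := Units.map (complexify n : Matrix (Fin n) (Fin n) ℝ →* Matrix (Fin n) (Fin n) ℂ)
    have hu : ∀ z ∈ s, E z ≠ 0 → ‖z * Complex.exp (-(Real.log ‖z‖ : ℂ))‖ = 1 := by
      intro z hz hEz
      obtain ⟨v, hv⟩ : ∃ v, (E z).mulVec v ≠ 0 := by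
        by_contra! h
        exact hEz (Matrix.toLin'.injective (LinearMap.ext fun v => by simpa using h v))
      have hz0 : 0 < ‖z‖ := zero_lt_one.trans (hnorm z hz v hv)
      rw [norm_mul, Complex.norm_exp, Complex.neg_re, Complex.ofReal_re, Real.exp_neg,
        Real.exp_log hz0, mul_inv_cancel₀ hz0.ne']
    have hU : ∀ z ∈ s, (φ (Hu * Su)).val * E z =
        (z * Complex.exp (-(Real.log ‖z‖ : ℂ))) • E z := by
      intro z hz
      change complexify n (NormedSpace.exp (-H) * Su.val) * E z = _
      rw [map_mul, complexify_exp, mul_assoc, hES z hz, mul_smul_comm, mul_smul, map_neg]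
      congr 1
      have h1 : SemiconjBy (E z) (-(Real.log ‖z‖ : ℂ) • 1) (-complexify n H) := by
        rw [SemiconjBy, mul_smul_comm, mul_one, neg_mul, hEH z hz, neg_smul]
      have h2 : E z * NormedSpace.exp (-(Real.log ‖z‖ : ℂ) • (1 : Matrix (Fin n) (Fin n) ℂ)) =
        NormedSpace.exp (-complexify n H) * E z := h1.exp_right.eq
      have h3 : NormedSpace.exp (-(Real.log ‖z‖ : ℂ) • (1 : Matrix (Fin n) (Fin n) ℂ)) =
        Complex.exp (-(Real.log ‖z‖ : ℂ)) • 1 := exp_smul_one _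
      rw [← h2, h3, mul_smul_comm, mul_one]
    obtain ⟨C, hC⟩ := exists_norm_zpow_le hE1 (φ (Hu * Su)) hu hU
    refine ⟨C, fun k => ?_⟩
    have := hC k
    rw [← map_zpow] at this
    rw [← norm_complexify]
    exact this

/-! ### Determinants of exponentials -/

theorem differentiable_det (n : ℕ) :
    Differentiable ℝ (Matrix.det : Matrix (Fin n) (Fin n) ℝ → ℝ) := by
  have hentry : ∀ i j, Differentiable ℝ fun M : Matrix (Fin n) (Fin n) ℝ => M i j := fun i j =>
    (LinearMap.toContinuousLinearMap
      (Matrix.entryLinearMap ℝ ℝ i j : Matrix (Fin n) (Fin n) ℝ →ₗ[ℝ] ℝ)).differentiable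
  have : (Matrix.det : Matrix (Fin n) (Fin n) ℝ → ℝ) =
      fun M => ∑ σ : Equiv.Perm (Fin n), ((Equiv.Perm.sign σ : ℤ) : ℝ) * ∏ i, M (σ i) i :=
    funext fun M => Matrix.det_apply' M
  rw [this]
  fun_prop

open Polynomial in
theorem hasDerivAt_det_one_add_smul {n : ℕ} (M : Matrix (Fin n) (Fin n) ℝ) :
    HasDerivAt (fun h : ℝ => (1 + h • M).det) M.trace 0 := by
  have h := (Matrix.det (1 + (X : ℝ[X]) • M.map C)).hasDerivAt (0 : ℝ)
  rw [Matrix.derivative_det_one_add_X_smul] at h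
  convert! h using 2 with t
  rw [← coe_evalRingHom, RingHom.map_det]
  congr 1
  ext i j
  by_cases hij : i = j <;> simp [hij] <;> exact mul_comm _ _

/-- `det (exp (s P)) = exp (s tr P)`: the left side is a multiplicative function of `s` whose
derivative at the origin is the trace, the derivative of the determinant at the identity. -/
theorem det_exp_smul {n : ℕ} (P : Matrix (Fin n) (Fin n) ℝ) (s : ℝ) :
    (NormedSpace.exp (s • P)).det = Real.exp (s * P.trace) := by
  let f : ℝ → ℝ := fun s => (NormedSpace.exp (s • P)).det
  have hadd : ∀ s h, f (s + h) = f s * f h := by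
    intro s h
    simp only [f]
    rw [add_smul, Matrix.exp_add_of_commute _ _ (((Commute.refl P).smul_left s).smul_right h),
      Matrix.det_mul]
  have hf0 : HasDerivAt f P.trace 0 := by
    have hD := (differentiable_det n (1 : Matrix (Fin n) (Fin n) ℝ)).hasFDerivAt
    have h1 : HasDerivAt (fun h : ℝ => (1 : Matrix (Fin n) (Fin n) ℝ) + h • P) P 0 := by
      have := ((hasDerivAt_id (0 : ℝ)).smul_const P).const_add (1 : Matrix (Fin n) (Fin n) ℝ)
      rwa [one_smul] at this
    have h2 : HasDerivAt (fun h : ℝ => NormedSpace.exp (h • P)) P 0 := by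
      have := hasDerivAt_exp_smul_const (𝕂 := ℝ) P 0
      rw [zero_smul, NormedSpace.exp_zero, one_mul] at this
      exact this
    have h3 := (HasFDerivAt.comp_hasDerivAt_of_eq (0 : ℝ) hD h1 (by simp)).unique
      (hasDerivAt_det_one_add_smul P)
    have h4 := HasFDerivAt.comp_hasDerivAt_of_eq (0 : ℝ) hD h2 (by simp)
    rw [h3] at h4
    exact h4
  have hf : ∀ s, HasDerivAt f (f s * P.trace) s := by
    intro s
    have h1 : HasDerivAt (fun u => f s * f (u - s)) (f s * P.trace) s := by
      refine HasDerivAt.const_mul _ ?_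
      have := HasDerivAt.comp_sub_const s s (f := f) (f' := P.trace) (by rwa [sub_self])
      exact this
    convert! h1 using 2 with u
    rw [← hadd, add_sub_cancel]
  have hg : ∀ s, HasDerivAt (fun s => f s * Real.exp (-(s * P.trace))) 0 s := by
    intro s
    have h1 := (hf s).mul (((hasDerivAt_id s).mul_const P.trace).neg.exp)
    convert! h1 using 1
    simp only [id]
    ring
  have h := is_const_of_deriv_eq_zero (fun s => (hg s).differentiableAt) (fun s => (hg s).deriv) s 0
  have hf1 : f 0 = 1 := by simp [f]
  simp only [hf1, zero_mul, neg_zero, Real.exp_zero, mul_one] at h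
  rw [Real.exp_neg, mul_inv_eq_one₀ (Real.exp_ne_zero _)] at h
  exact h

/-! ### One-parameter groups of dilations -/

/-- The invertible matrices `exp (s P)`, as a homomorphism from the additive group of reals. -/
noncomputable def expUnits {n : ℕ} (P : Matrix (Fin n) (Fin n) ℝ) :
    Multiplicative ℝ →* (Matrix (Fin n) (Fin n) ℝ)ˣ :=
  MonoidHom.toHomUnits
    { toFun := fun s => NormedSpace.exp (s.toAdd • P)
      map_one' := by simp
      map_mul' := fun s t => by
        rw [toAdd_mul, add_smul, Matrix.exp_add_of_commute _ _
          (((Commute.refl P).smul_left _).smul_right _)] }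

theorem val_expUnits {n : ℕ} (P : Matrix (Fin n) (Fin n) ℝ) (s : ℝ) :
    (expUnits P (.ofAdd s)).val = NormedSpace.exp (s • P) := rfl

theorem expUnits_zpow {n : ℕ} (P : Matrix (Fin n) (Fin n) ℝ) (s : ℝ) (k : ℤ) :
    expUnits P (.ofAdd s) ^ k = expUnits P (.ofAdd (k * s)) := by
  rw [← map_zpow, ← ofAdd_zsmul, zsmul_eq_mul]

theorem expUnits_inv {n : ℕ} (P : Matrix (Fin n) (Fin n) ℝ) (s : ℝ) :
    (expUnits P (.ofAdd s))⁻¹ = expUnits P (.ofAdd (-s)) := by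
  rw [← map_inv, ofAdd_neg]

theorem abs_det_expUnits {n : ℕ} {P : Matrix (Fin n) (Fin n) ℝ} (hP : P.trace = 1) (s : ℝ) :
    |(expUnits P (.ofAdd s)).val.det| = Real.exp s := by
  rw [val_expUnits, det_exp_smul, hP, mul_one, Real.abs_exp]

theorem exists_norm_expUnits_le {n : ℕ} (P : Matrix (Fin n) (Fin n) ℝ) (τ : ℝ) :
    ∃ K : ℝ, ∀ s, |s| ≤ τ → ‖(expUnits P (.ofAdd s)).val‖ ≤ K := by
  have hcont : Continuous fun s : ℝ => NormedSpace.exp (s • P) :=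
    NormedSpace.exp_continuous.comp (continuous_id.smul continuous_const)
  obtain ⟨K, hK⟩ := (isCompact_Icc (a := -τ) (b := τ)).exists_bound_of_continuousOn
    hcont.continuousOn
  exact ⟨K, fun s hs => hK s (abs_le.1 hs)⟩

theorem exp_mulVec_of_mulVec_eq_smul {n : ℕ} {M : Matrix (Fin n) (Fin n) ℂ} {ν : ℂ}
    {w : Fin n → ℂ} (h : M.mulVec w = ν • w) :
    (NormedSpace.exp M).mulVec w = Complex.exp ν • w := by
  let W : Matrix (Fin n) (Fin n) ℂ := Matrix.replicateCol (Fin n) w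
  have h1 : SemiconjBy W (ν • 1) M := by
    rw [SemiconjBy, mul_smul_comm, mul_one, ← Matrix.replicateCol_mulVec, h,
      Matrix.replicateCol_smul]
  have h2 : W * NormedSpace.exp (ν • (1 : Matrix (Fin n) (Fin n) ℂ)) = NormedSpace.exp M * W :=
    h1.exp_right.eq
  have h3 : NormedSpace.exp (ν • (1 : Matrix (Fin n) (Fin n) ℂ)) = Complex.exp ν • 1 :=
    exp_smul_one ν
  rw [h3, mul_smul_comm, mul_one, ← Matrix.replicateCol_mulVec, ← Matrix.replicateCol_smul] at h2
  ext i
  exact (congrFun (congrFun h2 i) i).symm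

theorem HasPositiveEigenvalues.isAnisotropicDilation_exp {n : ℕ} {P : Matrix (Fin n) (Fin n) ℝ}
    (hP : HasPositiveEigenvalues P) {s : ℝ} (hs : 0 < s) :
    IsAnisotropicDilation (NormedSpace.exp (s • P)) := by
  intro μ hμ
  obtain ⟨v, hv, h⟩ := (isComplexEigenvalue_iff_exists_mulVec _ _).1 hμ
  rw [← complexify_apply, complexify_exp, map_smul] at h
  have hcomm' : Commute (NormedSpace.exp (s • complexify n P)) (complexify n P) :=
    ((Commute.refl _).smul_left s).exp_left
  have hcomm : Commute (Matrix.toLin' (NormedSpace.exp (s • complexify n P)))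
      (Matrix.toLin' (complexify n P)) := hcomm'.map Matrix.toLinAlgEquiv'
  obtain ⟨ν, w, hw, h1, h2⟩ := exists_common_eigenvector hcomm hv h
  rw [Matrix.toLin'_apply] at h1 h2
  obtain ⟨r, hr, rfl⟩ := hP ν ((isComplexEigenvalue_iff_exists_mulVec _ _).2 ⟨w, hw, h2⟩)
  have h3 : (s • complexify n P).mulVec w = ((s * r : ℝ) : ℂ) • w := by
    rw [Matrix.smul_mulVec, h2, Complex.coe_smul, Complex.coe_smul, mul_smul]
  rw [exp_mulVec_of_mulVec_eq_smul h3] at h1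
  rw [← smul_left_injective ℂ hw h1, Complex.norm_exp, Complex.ofReal_re, Real.one_lt_exp_iff]
  positivity

theorem HasPositiveEigenvalues.smul {n : ℕ} {P : Matrix (Fin n) (Fin n) ℝ}
    (hP : HasPositiveEigenvalues P) {c : ℝ} (hc : 0 < c) : HasPositiveEigenvalues (c • P) := by
  intro μ hμ
  obtain ⟨v, hv, h⟩ := (isComplexEigenvalue_iff_exists_mulVec _ _).1 hμ
  rw [← complexify_apply, map_smul, Matrix.smul_mulVec] at h
  have hc' : (c : ℂ) ≠ 0 := Complex.ofReal_ne_zero.2 hc.ne'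
  obtain ⟨r, hr, h1⟩ := hP ((c : ℂ)⁻¹ * μ) ((isComplexEigenvalue_iff_exists_mulVec _ _).2
    ⟨v, hv, by rw [mul_smul, ← h, ← Complex.coe_smul, inv_smul_smul₀ hc', complexify_apply]⟩)
  exact ⟨c * r, by positivity, by rw [Complex.ofReal_mul, ← h1, mul_inv_cancel_left₀ hc']⟩

theorem abs_det_eq_one_of_norm_zpow_le {n : ℕ} {U : (Matrix (Fin n) (Fin n) ℝ)ˣ} {C : ℝ}
    (hC : ∀ k : ℤ, ‖(U ^ k).val‖ ≤ C) : |U.val.det| = 1 := by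
  obtain ⟨K, hK⟩ := (isCompact_closedBall (0 : Matrix (Fin n) (Fin n) ℝ)
    C).exists_bound_of_continuousOn (differentiable_det n).continuous.continuousOn
  have hpos : 0 < |U.val.det| :=
    abs_pos.2 ((Matrix.isUnit_iff_isUnit_det _).1 U.isUnit).ne_zero
  let δ : (Matrix (Fin n) (Fin n) ℝ)ˣ →* ℝˣ := Units.map Matrix.detMonoidHom
  refine eq_one_of_zpow_le (C := K) hpos fun k => ?_
  have h := hK (U ^ k).val (by simpa using hC k)
  have h1 : (U ^ k).val.det = U.val.det ^ k := by
    have := congrArg Units.val (map_zpow δ U k)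
    rwa [Units.val_zpow_eq_zpow_val] at this
  rwa [h1, Real.norm_eq_abs, abs_zpow] at h

/-- Every dilation is equivalent to all the dilations of a group whose generator has positive
eigenvalues and trace `1`. -/
theorem IsAnisotropicDilation.exists_generator {n : ℕ} (hn : 0 < n)
    {A : (Matrix (Fin n) (Fin n) ℝ)ˣ} (hA : IsAnisotropicDilation A.val) :
    ∃ P : Matrix (Fin n) (Fin n) ℝ, HasPositiveEigenvalues P ∧ P.trace = 1 ∧
      ∀ τ : ℝ, 0 < τ → DilationsEquivalent A.val (NormedSpace.exp (τ • P)) := by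
  obtain ⟨D, U, hAU, hDU, hD, C, hC⟩ := hA.exists_exp_mul
  have hdet : |A.val.det| = Real.exp D.trace := by
    have := det_exp_smul D 1
    rw [one_smul, one_mul] at this
    rw [hAU, Matrix.det_mul, abs_mul, abs_det_eq_one_of_norm_zpow_le hC, this, mul_one,
      Real.abs_exp]
  have hβ : 0 < D.trace := by
    have := hA.one_lt_abs_det hn
    rwa [hdet, Real.one_lt_exp_iff] at this
  set β := D.trace with hβdef
  let P := β⁻¹ • D
  have hP : HasPositiveEigenvalues P := hD.smul (inv_pos.2 hβ)
  have htr : P.trace = 1 := by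
    rw [Matrix.trace_smul, smul_eq_mul, ← hβdef, inv_mul_cancel₀ hβ.ne']
  have hDP : D = β • P := (smul_inv_smul₀ hβ.ne' D).symm
  have hA' : A = expUnits P (.ofAdd β) * U := by
    ext1
    rw [Units.val_mul, val_expUnits, ← hDP, hAU]
  refine ⟨P, hP, htr, fun τ hτ => ?_⟩
  have hB : IsAnisotropicDilation (expUnits P (.ofAdd τ)).val := hP.isAnisotropicDilation_exp hτ
  refine ⟨hA.exists_isHomogeneousQuasiNorm hn, hB.exists_isHomogeneousQuasiNorm hn,
    fun ρ₁ ρ₂ h₁ h₂ => ?_⟩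
  obtain ⟨K, hK⟩ := exists_norm_expUnits_le P τ
  have hK0 : 0 ≤ K := (norm_nonneg _).trans (hK 0 (by simpa using hτ.le))
  have hC0 : 0 ≤ C := (norm_nonneg _).trans (hC 0)
  refine quasiNormsEquivalent_of_zpow_eq (B₂ := expUnits P (.ofAdd τ)) hn hA hB
    (K * C + Real.exp τ) (fun k => ?_) h₁ h₂
  -- `A ^ k = exp (k β P) * U ^ k`, and `m` and `θ` are the quotient and the remainder
  -- in the division of `k β` by `τ`.
  let m : ℤ := ⌊k * β / τ⌋
  let θ : ℝ := k * β - m * τ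
  have hθ0 : 0 ≤ θ := by
    have := (le_div_iff₀ hτ).1 (Int.floor_le (k * β / τ))
    simp only [θ, m]
    linarith
  have hθτ : θ ≤ τ := by
    have := (div_lt_iff₀ hτ).1 (Int.lt_floor_add_one (k * β / τ))
    simp only [θ, m]
    linarith
  have hsum : m * τ + θ = k * β := by simp only [θ]; ring
  have hcomm : Commute (expUnits P (.ofAdd β)) U := by
    refine Units.ext ?_
    have h1 : Commute (NormedSpace.exp (β • P)) U.val := (hDP ▸ hDU).exp_left
    exact h1.eq
  have hk1 : |A.val.det| ^ k = Real.exp (k * β) := by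
    rw [hdet, ← Real.rpow_intCast, ← Real.exp_mul, mul_comm]
  have hk2 : |(expUnits P (.ofAdd τ)).val.det| ^ m = Real.exp (m * τ) := by
    rw [abs_det_expUnits htr, ← Real.rpow_intCast, ← Real.exp_mul, mul_comm]
  refine ⟨m, expUnits P (.ofAdd θ) * U ^ k, ?_, ?_, ?_, ?_, ?_⟩
  · rw [hA', hcomm.mul_zpow, expUnits_zpow, expUnits_zpow, ← mul_assoc, ← map_mul, ← ofAdd_add,
      hsum]
  · rw [Units.val_mul]
    refine (norm_mul_le _ _).trans ?_
    have h1 := hK θ (by rwa [abs_of_nonneg hθ0])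
    have h2 := mul_le_mul h1 (hC k) (norm_nonneg _) hK0
    have := Real.exp_pos τ
    linarith
  · rw [mul_inv_rev, Units.val_mul, ← zpow_neg, expUnits_inv]
    refine (norm_mul_le _ _).trans ?_
    have h1 := hK (-θ) (by rwa [abs_neg, abs_of_nonneg hθ0])
    have h2 := mul_le_mul (hC (-k)) h1 (norm_nonneg _) hC0
    have := Real.exp_pos τ
    nlinarith
  · rw [hk1, hk2, ← hsum, Real.exp_add]
    have h1 : Real.exp θ ≤ K * C + Real.exp τ := by
      have := Real.exp_le_exp.2 hθτ
      have := mul_nonneg hK0 hC0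
      linarith
    rw [mul_comm]
    gcongr
  · rw [hk1, hk2]
    have h1 : Real.exp (m * τ) ≤ Real.exp (k * β) := Real.exp_le_exp.2 (by linarith)
    have h2 : 1 ≤ K * C + Real.exp τ := by
      have := Real.one_le_exp hτ.le
      have := mul_nonneg hK0 hC0
      linarith
    exact h1.trans (le_mul_of_one_le_left (Real.exp_pos _).le h2)

theorem matrix_norm_le_of_mulVec {n : ℕ} {M : Matrix (Fin n) (Fin n) ℝ} {R : ℝ} (hR : 0 ≤ R)
    (h : ∀ x : Fin n → ℝ, ‖x‖ = 1 → ‖M.mulVec x‖ ≤ R) : ‖M‖ ≤ R := by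
  rw [Matrix.linfty_opNorm_eq_opNorm]
  exact ContinuousLinearMap.opNorm_le_of_unit_norm hR h

theorem HasPositiveEigenvalues.im_eq_zero {n : ℕ} {P : Matrix (Fin n) (Fin n) ℝ}
    (hP : HasPositiveEigenvalues P) : ∀ z ∈ spectrum ℂ (complexify n P), z.im = 0 := by
  intro z hz
  obtain ⟨r, -, rfl⟩ := hP z ((isComplexEigenvalue_iff_mem_spectrum _ _).2 hz)
  exact Complex.ofReal_im r

/-- The generator is determined by a single dilation of its group, up to equivalence. With
`B = exp (τ P)` and `B' = exp (τ P')` of the same determinant, equivalence of the quasi-norms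
bounds the quasi-norm of `B ^ (-k) B' ^ k x` uniformly in `k`. -/
theorem eq_of_dilationsEquivalent_exp {n : ℕ} (hn : 0 < n) {A P P' : Matrix (Fin n) (Fin n) ℝ}
    (hP : HasPositiveEigenvalues P) (hP' : HasPositiveEigenvalues P') (htr : P.trace = 1)
    (htr' : P'.trace = 1) {τ : ℝ} (hτ : 0 < τ)
    (h : DilationsEquivalent A (NormedSpace.exp (τ • P)))
    (h' : DilationsEquivalent A (NormedSpace.exp (τ • P'))) : P = P' := by
  obtain ⟨ρA, hρA⟩ := h.exists_left
  obtain ⟨ρ, hρ⟩ := h.exists_right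
  obtain ⟨ρ', hρ'⟩ := h'.exists_right
  obtain ⟨C, hC, hequiv⟩ :=
    ((h'.equivalent _ _ hρA hρ').symm.trans (h.equivalent _ _ hρA hρ))
  have hB : IsAnisotropicDilation (expUnits P (.ofAdd τ)).val := hP.isAnisotropicDilation_exp hτ
  have hB' : IsAnisotropicDilation (expUnits P' (.ofAdd τ)).val :=
    hP'.isAnisotropicDilation_exp hτ
  rw [← val_expUnits] at hρ hρ'
  obtain ⟨M, hM, hup⟩ := hρ'.exists_le_of_norm_le hB' 1
  obtain ⟨R, hR⟩ := hρ.exists_norm_le_of_le hn hB (C * M)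
  have hR0 : 0 ≤ R := by
    have := hR 0 (by rw [(hρ.eq_zero_iff 0).2 rfl]; positivity)
    simpa using this
  have hbound : ∀ k : ℤ, ‖(expUnits P (.ofAdd τ) ^ (-k) * expUnits P' (.ofAdd τ) ^ k).val‖ ≤ R := by
    intro k
    refine matrix_norm_le_of_mulVec hR0 fun x hx => hR _ ?_
    rw [Units.val_mul, ← Matrix.mulVec_mulVec, hρ.apply_zpow_mulVec]
    have h1 := (hequiv ((expUnits P' (.ofAdd τ) ^ k).val.mulVec x)).2
    rw [hρ'.apply_zpow_mulVec, abs_det_expUnits htr'] at h1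
    rw [abs_det_expUnits htr]
    have hpos : 0 < Real.exp τ ^ k := zpow_pos (Real.exp_pos τ) k
    rw [zpow_neg, inv_mul_le_iff₀ hpos]
    calc _ ≤ C * (Real.exp τ ^ k * ρ' x) := h1
      _ ≤ C * (Real.exp τ ^ k * M) := by
        gcongr
        exact hup x hx.le
      _ = Real.exp τ ^ k * (C * M) := by ring
  refine complexify_injective n (eq_of_norm_exp_neg_mul_exp_le hP.im_eq_zero hP'.im_eq_zero hτ
    (C := R) fun k => ?_)
  have h1 := hbound k
  rw [expUnits_zpow, expUnits_zpow, Units.val_mul, val_expUnits, val_expUnits, ← norm_complexify,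
    map_mul, complexify_exp, complexify_exp, map_smul, map_smul, Int.cast_neg, neg_mul, neg_smul,
    ← smul_neg] at h1
  exact h1

/-- The continuous group generated by a matrix. -/
noncomputable def ContinuousGroup.ofGenerator {n : ℕ} (P : Matrix (Fin n) (Fin n) ℝ) :
    ContinuousGroup n where
  toFun t := NormedSpace.exp (Real.log (t : ℝ) • P)
  map_one' := by simp
  map_mul' s t := by
    rw [Positive.val_mul, Real.log_mul s.2.ne' t.2.ne', add_smul, Matrix.exp_add_of_commute _ _
      (((Commute.refl P).smul_left _).smul_right _)]
  continuous_toFun := by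
    have h : Continuous fun t : {t : ℝ // 0 < t} => Real.log (t : ℝ) :=
      continuous_subtype_val.log fun t => t.2.ne'
    exact NormedSpace.exp_continuous.comp (h.smul continuous_const)

theorem theorem3p1 (n : ℕ) (hn : 0 < n) (A : Matrix (Fin n) (Fin n) ℝ)
    (hA : IsAnisotropicDilation A) :
    (∃! G : ContinuousGroup n,
      (∃ P : Matrix (Fin n) (Fin n) ℝ,
        HasGenerator G P ∧ HasPositiveEigenvalues P ∧ P.trace = 1) ∧
      ∀ t : {t : ℝ // 0 < t}, 1 < (t : ℝ) →
        IsAnisotropicDilation (G t) ∧ DilationsEquivalent A (G t)) ∧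
    (∀ (G G' : ContinuousGroup n) (P P' : Matrix (Fin n) (Fin n) ℝ),
      HasGenerator G P → HasPositiveEigenvalues P → P.trace = 1 →
      (∀ t : {t : ℝ // 0 < t}, 1 < (t : ℝ) → DilationsEquivalent A (G t)) →
      HasGenerator G' P' → HasPositiveEigenvalues P' → P'.trace = 1 →
      (∃ t : {t : ℝ // 0 < t}, 1 < (t : ℝ) ∧ DilationsEquivalent A (G' t)) →
      P = P') := by
  have huniq : ∀ (G G' : ContinuousGroup n) (P P' : Matrix (Fin n) (Fin n) ℝ),
      HasGenerator G P → HasPositiveEigenvalues P → P.trace = 1 →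
      (∀ t : {t : ℝ // 0 < t}, 1 < (t : ℝ) → DilationsEquivalent A (G t)) →
      HasGenerator G' P' → HasPositiveEigenvalues P' → P'.trace = 1 →
      (∃ t : {t : ℝ // 0 < t}, 1 < (t : ℝ) ∧ DilationsEquivalent A (G' t)) → P = P' := by
    rintro G G' P P' hG hP htr hequiv hG' hP' htr' ⟨t, ht, h'⟩
    have h := hequiv t ht
    rw [hG t] at h
    rw [hG' t] at h'
    exact eq_of_dilationsEquivalent_exp hn hP hP' htr htr' (Real.log_pos ht) h h'
  refine ⟨?_, huniq⟩
  obtain ⟨A, rfl⟩ := hA.isUnit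
  obtain ⟨P, hP, htr, hequiv⟩ := hA.exists_generator hn
  refine ⟨ContinuousGroup.ofGenerator P, ⟨⟨P, fun t => rfl, hP, htr⟩, fun t ht =>
    ⟨hP.isAnisotropicDilation_exp (Real.log_pos ht), hequiv _ (Real.log_pos ht)⟩⟩, ?_⟩
  rintro G' ⟨⟨P', hG', hP', htr'⟩, h'⟩
  have hPP' : P' = P := huniq G' (ContinuousGroup.ofGenerator P) P' P hG' hP' htr'
    (fun t ht => (h' t ht).2) (fun t => rfl) hP htr
    ⟨⟨2, two_pos⟩, one_lt_two, hequiv _ (Real.log_pos one_lt_two)⟩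
  refine ContinuousMonoidHom.ext fun t => ?_
  rw [hG' t, hPP']
  rfl
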